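/- Let $G=\langle a,b,c,d,s,t \mid c=ab,\ c=ba,\ d=c^2,\ s^{-1}as=d,\ t^{-1}bt=d\rangle$ be Wise's group, and let $X=\{a,b,c,d,s,t\}$. Then: 1. $(G,X)$ is almost convex: $X$ is a finite generating set of $G$, and there is a constant $C>0$ such that for every integer $N\ge 0$ and all $g,g'\in G$ that lie on the sphere of radius $N$ about $1$ in the Cayley graph $\Gamma(G,X)$ and are at distance at most $2$ from each other in $\Gamma(G,X)$, there is an edge path in $\Gamma(G,X)$ from $g$ to $g'$ of length at most $C$ that runs inside the closed metric ball of radius $N$ about $1$. (Here $\Gamma(G,X)$ is the metric graph whose edges have length $1$, so the interiors of the edges of the path must lie in the ball too.) 2. $G$ is non-Hopfian: there is a surjective homomorphism $G\to G$ that is not injective. -/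

import Mathlib

/-- A group is Hopfian if each of its surjective endomorphisms is injective. -/
def IsHopfian (G : Type*) [Group G] : Prop :=
  ∀ f : G →* G, Function.Surjective f → Function.Injective f

/-- The word length of `g` with respect to `X`, i.e. the distance from `1` to `g` in the Cayley
graph, for a generating set `X`. -/
noncomputable def wordLength {G : Type*} [Group G] (X : Set G) (g : G) : ℕ :=
  (SimpleGraph.mulCayley X).dist 1 g

/-- The edge path `p` runs inside the closed metric ball of radius `N` about `1` in the Cayley
graph, which is regarded as a metric graph with edges of length one. The point at distance `t` from
`u` on an edge from `u` to `v` has distance `min (|u| + t) (|v| + 1 - t)` from `1`; hence the edges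
contained in the ball are those whose endpoints lie in the ball and are not both on the sphere. -/
def RunsInsideBall {G : Type*} [Group G] (X : Set G) (N : ℕ) {g h : G}
    (p : (SimpleGraph.mulCayley X).Walk g h) : Prop :=
  (∀ v ∈ p.support, wordLength X v ≤ N) ∧
    ∀ e ∈ p.darts, ¬ (wordLength X e.fst = N ∧ wordLength X e.snd = N)

/-- `X` is a finite generating set of `G`, and `(G, X)` is almost convex: for some constant `C > 0`
and all `N`, any two elements of the sphere of radius `N` at distance at most `2` are joined by a
path of length at most `C` which runs inside the ball of radius `N`. -/
structure IsAlmostConvex (G : Type*) [Group G] (X : Set G) : Prop where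
  finite : X.Finite
  generates : Subgroup.closure X = ⊤
  exists_bound : ∃ C : ℕ, 0 < C ∧ ∀ (N : ℕ) (g h : G),
    wordLength X g = N → wordLength X h = N → (SimpleGraph.mulCayley X).dist g h ≤ 2 →
      ∃ p : (SimpleGraph.mulCayley X).Walk g h, p.length ≤ C ∧ RunsInsideBall X N p

namespace Wise

/-- The six generators of Wise's example. -/
inductive Gen
  | a | b | c | d | s | t
  deriving DecidableEq

open FreeGroup in
/-- The relators of the relations `c = ab`, `c = ba`, `d = c²`, `s⁻¹as = d`, `t⁻¹bt = d`. -/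
def relators : Set (FreeGroup Gen) :=
  {of .c * (of .a * of .b)⁻¹,
   of .c * (of .b * of .a)⁻¹,
   of .d * (of .c ^ 2)⁻¹,
   (of .s)⁻¹ * of .a * of .s * (of .d)⁻¹,
   (of .t)⁻¹ * of .b * of .t * (of .d)⁻¹}

end Wise

/-- Wise's group `⟨a, b, c, d, s, t ∣ c = ab, c = ba, d = c², s⁻¹as = d, t⁻¹bt = d⟩`. -/
abbrev WiseGroup : Type := PresentedGroup Wise.relators

open PresentedGroup in
/-- The subset `{a, b, c, d, s, t}` of Wise's group. -/
def Wise.generators : Set WiseGroup :=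
  {of .a, of .b, of .c, of .d, of .s, of .t}

/-! Wise's group is an HNN extension of `ℤ² = ⟨a, b⟩` with stable letters `s`, `t` that conjugate
`⟨a⟩` and `⟨b⟩` to `⟨d⟩`, where `d = (2,2)`. Its Cayley graph is a tree of sheets (cosets of `ℤ²`)
joined by strips of letter edges along lines of directions `a`, `b`, `d`. A path from `1` reaches a
sheet across one entry line. If `f` gives the distances from `1` on that line, of direction `u`, the
distance at `z` is the minimum over the feet `k` of `f k + norm (z - k u)`. Restricting to an exit
line and adding `1` gives the `f` of the next sheet, so word length is computed recursively
(`wordLength_eq_lev`).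

The invariant that carries the proof is `DyadicConvex`: `f` is `1`-Lipschitz and convex up to an
additive error of `1` at the scales `2, 4, 8, …`. It passes from the entry line to every exit line
with the same error (`IsDist.dyadicConvex`), so nothing accumulates along an itinerary. Passing from
a `d`-line to an `a`- or `b`-line halves the scale needed, and the converse passage doubles it;
hence all powers of two occur together.

For almost convexity, consider two nearby points of one sheet. Far from the entry line they can
descend in a common direction and be joined lower down. Near it they descend to feet and are joined
through the line across the strip, one level lower; approximate convexity at scale `2` keeps this
path in the ball (`IsDist.linked`, `linked_of_parallel`). A pair of endpoints whose connecting path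
uses letter edges reduces to a short detour in `linked_of_adj_adj`.

The endomorphism squaring `a` and `b` and fixing `s` and `t` is onto: it sends `c` to `d`, and `s`,
`t` recover `a`, `b` from `d`. It kills `[s c s⁻¹, b]`, which the normal form shows to be
nontrivial. -/

namespace Wise

/-! ### The norm on a sheet and approximate convexity on a line -/

/-- The word norm on `ℤ²` with respect to `(1,0)`, `(0,1)`, `(1,1)` and `(2,2)`. -/
def norm (x y : ℤ) : ℤ :=
  max (x - y) (y - x) + (max 0 (max (min x y) (-max x y)) + 1) / 2

/-- `f` satisfies the exchange inequality for the shift `W`. -/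
def Exchange (W : ℤ) (f : ℤ → ℤ) : Prop :=
  ∀ x y, x ≤ y → f (x + W) + f y ≤ f x + f (y + W) + 1

theorem Exchange.apply {W : ℤ} {f : ℤ → ℤ} (h : Exchange W f) {x y x' y' : ℤ} (hxy : x ≤ y)
    (hx : x' = x + W) (hy : y' = y + W) : f x' + f y ≤ f x + f y' + 1 := by
  subst hx hy; exact h x y hxy

theorem Exchange.comp_neg {W : ℤ} {f : ℤ → ℤ} (h : Exchange W f) :
    Exchange W fun k => f (-k) := by
  intro x y hxy
  have := h.apply (x := -(y + W)) (y := -(x + W)) (x' := -y) (y' := -x)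
    (by omega) (by omega) (by omega)
  dsimp only
  omega

/-- `f` is `1`-Lipschitz. -/
def Lip (f : ℤ → ℤ) : Prop :=
  ∀ x y, f x ≤ f y + max (x - y) (y - x)

theorem Lip.of_succ {f : ℤ → ℤ} (h : ∀ x, f (x + 1) ≤ f x + 1 ∧ f x ≤ f (x + 1) + 1) :
    Lip f := by
  have key : ∀ (n : ℕ) (x : ℤ), f (x + n) ≤ f x + n ∧ f x ≤ f (x + n) + n := by
    intro n
    induction n with
    | zero => intro x; simp
    | succ n ih =>
      intro x
      have h1 := ih x
      have h2 := h (x + n)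
      rw [show x + ((n + 1 : ℕ) : ℤ) = x + n + 1 by push_cast; ring]
      push_cast
      omega
  intro x y
  rcases le_total x y with hxy | hxy
  · have := key (y - x).toNat x
    rw [show x + ((y - x).toNat : ℤ) = y by omega] at this
    omega
  · have := key (x - y).toNat y
    rw [show y + ((x - y).toNat : ℤ) = x by omega] at this
    omega

theorem Lip.comp_neg {f : ℤ → ℤ} (h : Lip f) : Lip fun k => f (-k) := by
  intro x y
  have := h (-x) (-y)
  dsimp only
  omega

/-- Lipschitz functions which are convex up to an error of `1` at all scales `2, 4, 8, …`. -/
structure DyadicConvex (f : ℤ → ℤ) : Prop where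
  lip : Lip f
  exchange : ∀ n : ℕ, Exchange (2 * 2 ^ n) f

/-! ### Distances on a sheet and the windows of optimal feet -/

/-- `ℓ` is the distance function on a sheet whose entry line is in the direction of `(2,2)` and
has distances `f`. -/
structure DistD (f : ℤ → ℤ) (ℓ : ℤ → ℤ → ℤ) : Prop where
  exists_eq : ∀ x y, ∃ k, ℓ x y = f k + norm (x - 2 * k) (y - 2 * k)
  le : ∀ x y k, ℓ x y ≤ f k + norm (x - 2 * k) (y - 2 * k)

/-- `ℓ` is the distance function on a sheet whose entry line is in the direction of `(1,0)` and
has distances `f`. -/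
structure DistA (f : ℤ → ℤ) (ℓ : ℤ → ℤ → ℤ) : Prop where
  exists_eq : ∀ x y, ∃ k, ℓ x y = f k + norm (x - k) y
  le : ∀ x y k, ℓ x y ≤ f k + norm (x - k) y

namespace DistD
variable {f : ℤ → ℤ} {ℓ : ℤ → ℤ → ℤ}

theorem swap (h : DistD f ℓ) : DistD f fun x y => ℓ y x := by
  refine ⟨fun x y => ?_, fun x y k => ?_⟩
  · obtain ⟨k, hk⟩ := h.exists_eq y x
    exact ⟨k, by unfold norm at *; omega⟩
  · have := h.le y x k
    unfold norm at *; omega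

theorem neg (h : DistD f ℓ) : DistD (fun k => f (-k)) fun x y => ℓ (-x) (-y) := by
  refine ⟨fun x y => ?_, fun x y k => ?_⟩
  · obtain ⟨k, hk⟩ := h.exists_eq (-x) (-y)
    refine ⟨-k, ?_⟩
    rw [neg_neg]
    unfold norm at *; omega
  · have := h.le (-x) (-y) (-k)
    unfold norm at *; omega

/-- Moving `k` by one toward the window `y ≤ 2k ≤ x` saves one in the norm and, by the Lipschitz
property, costs at most one in `f`. So some optimal foot lies in the window, where the norm is
constantly `x - y`. If `x = y` is odd the window contains no foot, and the two nearest ones replace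
it. -/
theorem exists_window (h : DistD f ℓ) (hf : Lip f) {x y : ℤ} (hxy : y ≤ x) :
    ∃ k, (y ≤ 2 * k ∧ 2 * k ≤ x ∧ ℓ x y = x - y + f k) ∨
      (x = y ∧ (x = 2 * k + 1 ∨ x = 2 * k - 1) ∧ ℓ x y = 1 + f k) := by
  obtain ⟨k, hk⟩ := h.exists_eq x y
  by_cases h1 : 2 * k < y
  · by_cases h2 : 2 * ((y + 1) / 2) ≤ x
    · refine ⟨(y + 1) / 2, Or.inl ⟨by omega, h2, ?_⟩⟩
      have h3 := h.le x y ((y + 1) / 2)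
      have h4 := hf ((y + 1) / 2) k
      unfold norm at *; omega
    · refine ⟨y / 2, Or.inr ⟨by omega, by omega, ?_⟩⟩
      have h3 := h.le x y (y / 2)
      have h4 := hf (y / 2) k
      unfold norm at *; omega
  · by_cases h1' : x < 2 * k
    · by_cases h2 : y ≤ 2 * (x / 2)
      · refine ⟨x / 2, Or.inl ⟨by omega, by omega, ?_⟩⟩
        have h3 := h.le x y (x / 2)
        have h4 := hf (x / 2) k
        unfold norm at *; omega
      · refine ⟨(x + 1) / 2, Or.inr ⟨by omega, by omega, ?_⟩⟩
        have h3 := h.le x y ((x + 1) / 2)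
        have h4 := hf ((x + 1) / 2) k
        unfold norm at *; omega
    · exact ⟨k, Or.inl ⟨by omega, by omega, by unfold norm at hk; omega⟩⟩

theorem le_window (h : DistD f ℓ) {x y k : ℤ} (h1 : y ≤ 2 * k) (h2 : 2 * k ≤ x) :
    ℓ x y ≤ x - y + f k := by
  have := h.le x y k
  unfold norm at this; omega

theorem le_diag (h : DistD f ℓ) {x y k : ℤ} (hxy : x = y) (h1 : x = 2 * k + 1 ∨ x = 2 * k - 1) :
    ℓ x y ≤ 1 + f k := by
  have := h.le x y k
  unfold norm at this; omega

end DistD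

namespace DistA
variable {f : ℤ → ℤ} {ℓ : ℤ → ℤ → ℤ}

theorem neg (h : DistA f ℓ) : DistA (fun k => f (-k)) fun x y => ℓ (-x) (-y) := by
  refine ⟨fun x y => ?_, fun x y k => ?_⟩
  · obtain ⟨k, hk⟩ := h.exists_eq (-x) (-y)
    refine ⟨-k, ?_⟩
    rw [neg_neg]
    unfold norm at *; omega
  · have := h.le (-x) (-y) (-k)
    unfold norm at *; omega

/-- Feet are again pushed into a window, but the norm still varies there: `x - p` of the `y` upward
steps become diagonal, and diagonal steps merge in pairs. -/
theorem exists_window (h : DistA f ℓ) (hf : Lip f) {x y : ℤ} (hy : 0 ≤ y) :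
    ∃ p, x - y ≤ p ∧ p ≤ x ∧ ℓ x y = y - (x - p) / 2 + f p := by
  obtain ⟨k, hk⟩ := h.exists_eq x y
  by_cases h1 : k < x - y
  · refine ⟨x - y, by omega, by omega, ?_⟩
    have h3 := h.le x y (x - y)
    have h4 := hf (x - y) k
    unfold norm at *; omega
  · by_cases h2 : x < k
    · refine ⟨x, by omega, by omega, ?_⟩
      have h3 := h.le x y x
      have h4 := hf x k
      unfold norm at *; omega
    · exact ⟨k, by omega, by omega, by unfold norm at hk; omega⟩

theorem le_window (h : DistA f ℓ) {x y p : ℤ} (h1 : x - y ≤ p) (h2 : p ≤ x) :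
    ℓ x y ≤ y - (x - p) / 2 + f p := by
  have := h.le x y p
  unfold norm at this; omega

theorem exists_window_neg (h : DistA f ℓ) (hf : Lip f) {x y : ℤ} (hy : y ≤ 0) :
    ∃ p, x ≤ p ∧ p ≤ x - y ∧ ℓ x y = -y - (p - x) / 2 + f p := by
  obtain ⟨p, h1, h2, h3⟩ := h.neg.exists_window hf.comp_neg (x := -x) (y := -y) (by omega)
  refine ⟨-p, by omega, by omega, ?_⟩
  simp only [neg_neg] at h3
  omega

theorem le_window_neg (h : DistA f ℓ) {x y p : ℤ} (h1 : x ≤ p) (h2 : p ≤ x - y) :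
    ℓ x y ≤ -y - (p - x) / 2 + f p := by
  have := h.le x y p
  unfold norm at this; omega

end DistA

/-! ### Exchange inequalities on the lines of a sheet -/

theorem Exchange.comp_add {W : ℤ} {f : ℤ → ℤ} (h : Exchange W f) (c : ℤ) :
    Exchange W fun k => f (c + k) := fun x y hxy =>
  h.apply (x := c + x) (y := c + y) (by omega) (by omega) (by omega)

/-- For a function that decreases up to `c` and increases afterwards, an argument on the wrong side
of `c` can be moved to `c` or compared directly by monotonicity. -/
theorem Exchange.of_glue {W c : ℤ} {h : ℤ → ℤ} (hW : 0 ≤ W)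
    (mr : ∀ x y, c ≤ x → x ≤ y → h x ≤ h y) (ml : ∀ x y, x ≤ y → y ≤ c → h y ≤ h x)
    (er : ∀ x y, c ≤ x → x ≤ y → h (x + W) + h y ≤ h x + h (y + W) + 1)
    (el : ∀ x y, x ≤ y → y + W ≤ c → h (x + W) + h y ≤ h x + h (y + W) + 1) :
    Exchange W h := by
  intro x y hxy
  by_cases h1 : c ≤ x
  · exact er x y h1 hxy
  by_cases h2 : y + W ≤ c
  · exact el x y hxy h2
  by_cases h3 : c ≤ x + W
  · by_cases h4 : c ≤ y
    · have a1 := er c y le_rfl h4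
      have a2 := mr (x + W) (c + W) h3 (by omega)
      have a3 := ml x c (by omega) le_rfl
      omega
    · have a1 := mr (x + W) (y + W) h3 (by omega)
      have a2 := ml x y hxy (by omega)
      omega
  · by_cases h4 : c ≤ y
    · have a1 := mr y (y + W) h4 (by omega)
      have a2 := ml x (x + W) (by omega) (by omega)
      omega
    · have a1 := el x (c - W) (by omega) (by omega)
      rw [show c - W + W = c by ring] at a1
      have a2 := mr c (y + W) le_rfl (by omega)
      have a3 := ml (c - W) y (by omega) (by omega)
      omega

namespace DistD
variable {f : ℤ → ℤ} {ℓ : ℤ → ℤ → ℤ}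

/-- Let `p`, `q` be optimal feet for the two points on the right-hand side. If `p ≤ q - W`, the feet
`p + W` and `q - W` serve on the left and the exchange inequality of `f` bounds their cost.
Otherwise `p` and `q` can be swapped, because the windows are intervals. The later exchange proofs
vary this pattern. -/
theorem exchange_d_of_le (h : DistD f ℓ) (hf : Lip f) {W : ℤ}
    (hE : Exchange W f) {x y : ℤ} (hxy : y ≤ x) :
    Exchange W fun k => ℓ (x + 2 * k) (y + 2 * k) := by
  intro k l hkl
  obtain ⟨p, hp⟩ := h.exists_window hf (x := x + 2 * k) (y := y + 2 * k) (by omega)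
  obtain ⟨q, hq⟩ := h.exists_window hf (x := x + 2 * (l + W)) (y := y + 2 * (l + W)) (by omega)
  dsimp only
  by_cases hpq : p ≤ q - W
  · have e := hE.apply (x := p) (y := q - W) (x' := p + W) (y' := q) hpq rfl (by omega)
    rcases hp with ⟨p1, p2, p3⟩ | ⟨p1, p2, p3⟩
    · rcases hq with ⟨q1, q2, q3⟩ | ⟨q1, q2, q3⟩
      · have a1 := h.le_window (x := x + 2 * (k + W)) (y := y + 2 * (k + W)) (k := p + W)
          (by omega) (by omega)
        have a2 := h.le_window (x := x + 2 * l) (y := y + 2 * l) (k := q - W)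
          (by omega) (by omega)
        omega
      · omega
    · rcases hq with ⟨q1, q2, q3⟩ | ⟨q1, q2, q3⟩
      · omega
      · have a1 := h.le_diag (x := x + 2 * (k + W)) (y := y + 2 * (k + W)) (k := p + W)
          (by omega) (by omega)
        have a2 := h.le_diag (x := x + 2 * l) (y := y + 2 * l) (k := q - W)
          (by omega) (by omega)
        omega
  · rcases hp with ⟨p1, p2, p3⟩ | ⟨p1, p2, p3⟩
    · rcases hq with ⟨q1, q2, q3⟩ | ⟨q1, q2, q3⟩
      · have a1 := h.le_window (x := x + 2 * (k + W)) (y := y + 2 * (k + W)) (k := q)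
          (by omega) (by omega)
        have a2 := h.le_window (x := x + 2 * l) (y := y + 2 * l) (k := p)
          (by omega) (by omega)
        omega
      · omega
    · rcases hq with ⟨q1, q2, q3⟩ | ⟨q1, q2, q3⟩
      · omega
      · have a1 := h.le_diag (x := x + 2 * (k + W)) (y := y + 2 * (k + W)) (k := q)
          (by omega) (by omega)
        have a2 := h.le_diag (x := x + 2 * l) (y := y + 2 * l) (k := p)
          (by omega) (by omega)
        omega

theorem exchange_d (h : DistD f ℓ) (hf : Lip f) {W : ℤ}
    (hE : Exchange W f) (x y : ℤ) :
    Exchange W fun k => ℓ (x + 2 * k) (y + 2 * k) := by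
  rcases le_total y x with hxy | hxy
  · exact h.exchange_d_of_le hf hE hxy
  · exact h.swap.exchange_d_of_le hf hE hxy

theorem mono_a (h : DistD f ℓ) (hf : Lip f) {x x' y : ℤ} (hx : y ≤ x) (hxx : x ≤ x') :
    ℓ x y ≤ ℓ x' y := by
  obtain ⟨k, hk⟩ := h.exists_window hf (x := x') (y := y) (by omega)
  rcases hk with ⟨p1, p2, p3⟩ | ⟨p1, p2, p3⟩
  · by_cases h1 : 2 * k ≤ x
    · have := h.le_window (x := x) (y := y) p1 h1
      omega
    · by_cases h2 : y ≤ 2 * (x / 2)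
      · have a1 := h.le_window (x := x) (y := y) (k := x / 2) (by omega) (by omega)
        have a2 := hf (x / 2) k
        omega
      · have a1 := h.le_diag (x := x) (y := y) (k := (x + 1) / 2) (by omega) (by omega)
        have a2 := hf ((x + 1) / 2) k
        omega
  · obtain rfl : x = x' := by omega
    exact le_rfl

/-- Feet are `(2,2)` apart, so a shift by `2W` on an `a`-line moves the end of the window by only
`W` feet. For `W = 1`, a scale absent from `DyadicConvex`, moving one foot by one costs at most the
permitted error. -/
theorem exchange_a_right (h : DistD f ℓ) (hf : Lip f) {W : ℤ} (hW : 0 < W)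
    (hE : W = 1 ∨ Exchange W f) (y : ℤ) {x₁ x₂ : ℤ} (h1 : y ≤ x₁) (h2 : x₁ ≤ x₂) :
    ℓ (x₁ + 2 * W) y + ℓ x₂ y ≤ ℓ x₁ y + ℓ (x₂ + 2 * W) y + 1 := by
  obtain ⟨q, hq⟩ := h.exists_window hf (x := x₂ + 2 * W) (y := y) (by omega)
  replace hq : y ≤ 2 * q ∧ 2 * q ≤ x₂ + 2 * W ∧ ℓ (x₂ + 2 * W) y = x₂ + 2 * W - y + f q := by
    omega
  obtain ⟨q1, q2, q3⟩ := hq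
  obtain ⟨p, hp⟩ := h.exists_window hf (x := x₁) (y := y) (by omega)
  rcases hp with ⟨p1, p2, p3⟩ | ⟨p1, p2, p3⟩
  · by_cases hq2 : 2 * q ≤ x₂
    · have a1 := h.le_window (x := x₁ + 2 * W) (y := y) (k := p) (by omega) (by omega)
      have a2 := h.le_window (x := x₂) (y := y) (k := q) (by omega) (by omega)
      omega
    by_cases hpq : q - W < p
    · have a1 := h.le_window (x := x₁ + 2 * W) (y := y) (k := q) (by omega) (by omega)
      have a2 := h.le_window (x := x₂) (y := y) (k := p) (by omega) (by omega)
      omega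
    rcases hE with rfl | hE
    · have a1 := h.le_window (x := x₁ + 2 * 1) (y := y) (k := p) (by omega) (by omega)
      have a2 := h.le_window (x := x₂) (y := y) (k := q - 1) (by omega) (by omega)
      have a3 := hf (q - 1) q
      omega
    · have e := hE.apply (x := p) (y := q - W) (x' := p + W) (y' := q) (by omega) rfl (by omega)
      have a1 := h.le_window (x := x₁ + 2 * W) (y := y) (k := p + W) (by omega) (by omega)
      have a2 := h.le_window (x := x₂) (y := y) (k := q - W) (by omega) (by omega)
      omega
  · by_cases h3 : x₂ = x₁
    · subst h3; omega
    -- Here `x₁ = y` is odd with nearest feet `K - 1` and `K`, both just outside the window; the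
    -- extra `1` in `ℓ x₁ y` pays for passing from `p` to the other one.
    set K := (y + 1) / 2 with hK
    have b1 := hf K p
    have b2 := hf (K - 1) p
    by_cases hq2 : 2 * q ≤ x₂
    · have a1 := h.le_window (x := x₁ + 2 * W) (y := y) (k := K) (by omega) (by omega)
      have a2 := h.le_window (x := x₂) (y := y) (k := q) (by omega) (by omega)
      omega
    by_cases hpq : q - W < K
    · have a1 := h.le_window (x := x₁ + 2 * W) (y := y) (k := q) (by omega) (by omega)
      have a2 := h.le_window (x := x₂) (y := y) (k := K) (by omega) (by omega)
      omega
    rcases hE with rfl | hE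
    · have a1 := h.le_window (x := x₁ + 2 * 1) (y := y) (k := K) (by omega) (by omega)
      have a2 := h.le_window (x := x₂) (y := y) (k := q - 1) (by omega) (by omega)
      have a3 := hf (q - 1) q
      omega
    · have e := hE.apply (x := K - 1) (y := q - W) (x' := K - 1 + W) (y' := q) (by omega) rfl
        (by omega)
      have a1 := h.le_window (x := x₁ + 2 * W) (y := y) (k := K - 1 + W) (by omega) (by omega)
      have a2 := h.le_window (x := x₂) (y := y) (k := q - W) (by omega) (by omega)
      omega

theorem exchange_a (h : DistD f ℓ) (hf : Lip f) {W : ℤ} (hW : 0 < W)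
    (hE : W = 1 ∨ Exchange W f) (y : ℤ) : Exchange (2 * W) fun x => ℓ x y := by
  have hs := h.swap.neg
  have hEs : W = 1 ∨ Exchange W fun k => f (-k) := hE.imp_right Exchange.comp_neg
  refine Exchange.of_glue (c := y) (by omega) (fun x x' => h.mono_a hf) ?_
    (fun x₁ x₂ => h.exchange_a_right hf hW hE y) ?_
  · intro x x' hxx hx
    have h1 := h.neg.mono_a hf.comp_neg (y := -y) (x := -x') (x' := -x) (by omega) (by omega)
    simpa using h1
  · intro x₁ x₂ h12 h2
    have h1 := h.neg.exchange_a_right hf.comp_neg hW hEs (-y) (x₁ := -(x₂ + 2 * W))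
      (x₂ := -(x₁ + 2 * W)) (by omega) (by omega)
    rw [show -(x₂ + 2 * W) + 2 * W = -x₂ by ring, show -(x₁ + 2 * W) + 2 * W = -x₁ by ring] at h1
    simp only [neg_neg] at h1
    omega

end DistD

namespace DistA
variable {f : ℤ → ℤ} {ℓ : ℤ → ℤ → ℤ}

theorem exchange_a_of_nonneg (h : DistA f ℓ) (hf : Lip f) {W : ℤ}
    (hE : Exchange W f) {y : ℤ} (hy : 0 ≤ y) : Exchange W fun x => ℓ x y := by
  intro x₁ x₂ hx
  obtain ⟨p, p1, p2, p3⟩ := h.exists_window hf (x := x₁) hy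
  obtain ⟨q, q1, q2, q3⟩ := h.exists_window hf (x := x₂ + W) hy
  dsimp only
  by_cases hpq : p ≤ q - W
  · have e := hE.apply (x := p) (y := q - W) (x' := p + W) (y' := q) hpq rfl (by omega)
    have a1 := h.le_window (x := x₁ + W) (y := y) (p := p + W) (by omega) (by omega)
    have a2 := h.le_window (x := x₂) (y := y) (p := q - W) (by omega) (by omega)
    rw [show x₁ + W - (p + W) = x₁ - p by ring] at a1
    rw [show x₂ - (q - W) = x₂ + W - q by ring] at a2
    omega
  · have a1 := h.le_window (x := x₁ + W) (y := y) (p := q) (by omega) (by omega)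
    have a2 := h.le_window (x := x₂) (y := y) (p := p) (by omega) (by omega)
    omega

theorem exchange_a (h : DistA f ℓ) (hf : Lip f) {W : ℤ}
    (hE : Exchange W f) (y : ℤ) : Exchange W fun x => ℓ x y := by
  rcases le_total 0 y with hy | hy
  · exact h.exchange_a_of_nonneg hf hE hy
  · have := (h.neg.exchange_a_of_nonneg hf.comp_neg hE.comp_neg (y := -y) (by omega)).comp_neg
    simpa using this

/-- The window `[x - y, x]` grows to the left with `y`. Evenness of `W` keeps the rounding in `(x -
p) / 2` unchanged when a foot moves by `W`. -/
theorem exchange_b_right (h : DistA f ℓ) (hf : Lip f) {W : ℤ} (hW : 0 < W) (hW2 : W % 2 = 0)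
    (hE : Exchange W f) (x : ℤ) {y₁ y₂ : ℤ} (h0 : 0 ≤ y₁) (h12 : y₁ ≤ y₂) :
    ℓ x (y₁ + W) + ℓ x y₂ ≤ ℓ x y₁ + ℓ x (y₂ + W) + 1 := by
  obtain ⟨p, p1, p2, p3⟩ := h.exists_window hf (x := x) (y := y₁) h0
  obtain ⟨q, q1, q2, q3⟩ := h.exists_window hf (x := x) (y := y₂ + W) (by omega)
  by_cases hq : x - y₂ ≤ q
  · have a1 := h.le_window (x := x) (y := y₁ + W) (p := p) (by omega) (by omega)
    have a2 := h.le_window (x := x) (y := y₂) (p := q) (by omega) (by omega)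
    omega
  by_cases hpq : q + W ≤ p
  · have e := hE.apply (x := q) (y := p - W) (x' := q + W) (y' := p) (by omega) rfl (by omega)
    have a1 := h.le_window (x := x) (y := y₁ + W) (p := p - W) (by omega) (by omega)
    have a2 := h.le_window (x := x) (y := y₂) (p := q + W) (by omega) (by omega)
    omega
  · have a1 := h.le_window (x := x) (y := y₁ + W) (p := q) (by omega) (by omega)
    have a2 := h.le_window (x := x) (y := y₂) (p := p) (by omega) (by omega)
    omega

/-- Along a `b`-line the distance need not increase away from the entry line, so `Exchange.of_glue`
is not available and each position of the arguments relative to the entry line needs its own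
exchange of feet. -/
theorem exchange_b_straddle (h : DistA f ℓ) (hf : Lip f) {W : ℤ} (hW : 0 < W) (hW2 : W % 2 = 0)
    (hE : Exchange W f) (x : ℤ) {y₁ y₂ : ℤ} (h0 : y₁ < 0) (h1 : 0 ≤ y₁ + W) (h2 : 0 ≤ y₂) :
    ℓ x (y₁ + W) + ℓ x y₂ ≤ ℓ x y₁ + ℓ x (y₂ + W) + 1 := by
  obtain ⟨p, p1, p2, p3⟩ := h.exists_window_neg hf (x := x) (y := y₁) (by omega)
  obtain ⟨q, q1, q2, q3⟩ := h.exists_window hf (x := x) (y := y₂ + W) (by omega)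
  by_cases hv : x - y₂ ≤ q
  · have a1 := h.le_window (x := x) (y := y₁ + W) (p := x) (by omega) (by omega)
    have a2 := h.le_window (x := x) (y := y₂) (p := q) (by omega) (by omega)
    have a3 := hf x p
    omega
  by_cases hu : x - (y₁ + W) ≤ q
  · have a1 := h.le_window (x := x) (y := y₁ + W) (p := q) (by omega) (by omega)
    have a2 := h.le_window (x := x) (y := y₂) (p := x) (by omega) (by omega)
    have a3 := hf x p
    omega
  -- The far end of the window at height `y₁`, shifted by `-W`, is the far end of the window at
  -- height `y₁ + W`; it takes the place of `p`.
  have e := hE.apply (x := q) (y := x - y₁ - W) (x' := q + W) (y' := x - y₁) (by omega) rfl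
    (by omega)
  have a1 := h.le_window (x := x) (y := y₁ + W) (p := x - y₁ - W) (by omega) (by omega)
  have a3 := hf (x - y₁) p
  by_cases hn : q + W ≤ x
  · have a2 := h.le_window (x := x) (y := y₂) (p := q + W) (by omega) (by omega)
    omega
  · have a2 := h.le_window (x := x) (y := y₂) (p := x) (by omega) (by omega)
    have a4 := hf x (q + W)
    omega

theorem exchange_b_outer (h : DistA f ℓ) (hf : Lip f) {W : ℤ} (hW : 0 < W) (hW2 : W % 2 = 0)
    (hE : Exchange W f) (x : ℤ) {y₁ y₂ : ℤ} (h1 : y₁ + W < 0) (h2 : 0 < y₂) :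
    ℓ x (y₁ + W) + ℓ x y₂ ≤ ℓ x y₁ + ℓ x (y₂ + W) + 1 := by
  obtain ⟨p, p1, p2, p3⟩ := h.exists_window_neg hf (x := x) (y := y₁) (by omega)
  obtain ⟨q, q1, q2, q3⟩ := h.exists_window hf (x := x) (y := y₂ + W) (by omega)
  by_cases hu : p ≤ x - (y₁ + W)
  · have a1 := h.le_window_neg (x := x) (y := y₁ + W) (p := p) (by omega) (by omega)
    by_cases hv : x - y₂ ≤ q
    · have a2 := h.le_window (x := x) (y := y₂) (p := q) (by omega) (by omega)
      omega
    · have a2 := h.le_window (x := x) (y := y₂) (p := x - y₂) (by omega) (by omega)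
      have a3 := hf (x - y₂) q
      omega
  by_cases hv : x - y₂ ≤ q
  · have a1 := h.le_window_neg (x := x) (y := y₁ + W) (p := x - (y₁ + W)) (by omega) (by omega)
    have a2 := h.le_window (x := x) (y := y₂) (p := q) (by omega) (by omega)
    have a3 := hf (x - (y₁ + W)) p
    omega
  have b1 := hf x p
  have b2 := hf x q
  have a1 := h.le_window_neg (x := x) (y := y₁ + W) (p := x) (by omega) (by omega)
  have a2 := h.le_window (x := x) (y := y₂) (p := x) (by omega) (by omega)
  by_cases hpq : p - q < W
  · omega
  have e := hE.apply (x := q) (y := p - W) (x' := q + W) (y' := p) (by omega) rfl (by omega)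
  have b3 := hf x (p - W)
  have b4 := hf x (q + W)
  by_cases hp : x ≤ p - W
  · have a3 := h.le_window_neg (x := x) (y := y₁ + W) (p := p - W) (by omega) (by omega)
    by_cases hq : q + W ≤ x
    · have a4 := h.le_window (x := x) (y := y₂) (p := q + W) (by omega) (by omega)
      omega
    · omega
  · by_cases hq : q + W ≤ x
    · have a4 := h.le_window (x := x) (y := y₂) (p := q + W) (by omega) (by omega)
      omega
    · omega

theorem exchange_b_inner (h : DistA f ℓ) (hf : Lip f) {W : ℤ}
    (hE : Exchange W f) (x : ℤ) {y₁ y₂ : ℤ} (h12 : y₁ ≤ y₂) (h1 : 0 < y₁ + W) (h2 : y₂ < 0) :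
    ℓ x (y₁ + W) + ℓ x y₂ ≤ ℓ x y₁ + ℓ x (y₂ + W) + 1 := by
  obtain ⟨p, p1, p2, p3⟩ := h.exists_window_neg hf (x := x) (y := y₁) (by omega)
  obtain ⟨q, q1, q2, q3⟩ := h.exists_window hf (x := x) (y := y₂ + W) (by omega)
  by_cases hu : p ≤ x - y₂
  · have a1 := h.le_window_neg (x := x) (y := y₂) (p := p) (by omega) (by omega)
    by_cases hv : x - (y₁ + W) ≤ q
    · have a2 := h.le_window (x := x) (y := y₁ + W) (p := q) (by omega) (by omega)
      omega
    · have a2 := h.le_window (x := x) (y := y₁ + W) (p := x - (y₁ + W)) (by omega) (by omega)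
      have a3 := hf (x - (y₁ + W)) q
      omega
  have a1 := h.le_window_neg (x := x) (y := y₂) (p := x - y₂) (by omega) (by omega)
  have b1 := hf (x - y₂) p
  by_cases hv : x - (y₁ + W) ≤ q
  · have a2 := h.le_window (x := x) (y := y₁ + W) (p := q) (by omega) (by omega)
    omega
  have a2 := h.le_window (x := x) (y := y₁ + W) (p := x - (y₁ + W)) (by omega) (by omega)
  by_cases hpq : q ≤ p - W
  · have e := hE.apply (x := q) (y := p - W) (x' := q + W) (y' := p) hpq rfl (by omega)
    have b2 := hf (x - (y₁ + W)) (p - W)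
    have b3 := hf (x - y₂) (q + W)
    omega
  · have b2 := hf (x - (y₁ + W)) q
    omega

theorem exchange_b (h : DistA f ℓ) (hf : Lip f) {W : ℤ} (hW : 0 < W) (hW2 : W % 2 = 0)
    (hE : Exchange W f) (x : ℤ) : Exchange W fun y => ℓ x y := by
  intro y₁ y₂ h12
  dsimp only
  by_cases h1 : 0 ≤ y₁
  · exact h.exchange_b_right hf hW hW2 hE x h1 h12
  by_cases h2 : y₂ + W ≤ 0
  · have := h.neg.exchange_b_right hf.comp_neg hW hW2 hE.comp_neg (-x) (y₁ := -(y₂ + W))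
      (y₂ := -(y₁ + W)) (by omega) (by omega)
    rw [show -(y₂ + W) + W = -y₂ by ring, show -(y₁ + W) + W = -y₁ by ring] at this
    simp only [neg_neg] at this
    omega
  by_cases h3 : 0 ≤ y₁ + W
  · by_cases h4 : 0 ≤ y₂
    · exact h.exchange_b_straddle hf hW hW2 hE x (by omega) h3 h4
    by_cases h5 : y₁ + W = 0
    · have := h.neg.exchange_b_straddle hf.comp_neg hW hW2 hE.comp_neg (-x) (y₁ := -(y₂ + W))
        (y₂ := -(y₁ + W)) (by omega) (by omega) (by omega)
      rw [show -(y₂ + W) + W = -y₂ by ring, show -(y₁ + W) + W = -y₁ by ring] at this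
      simp only [neg_neg] at this
      omega
    · exact h.exchange_b_inner hf hE x h12 (by omega) (by omega)
  · by_cases h4 : 0 < y₂
    · exact h.exchange_b_outer hf hW hW2 hE x (by omega) h4
    · have := h.neg.exchange_b_straddle hf.comp_neg hW hW2 hE.comp_neg (-x) (y₁ := -(y₂ + W))
        (y₂ := -(y₁ + W)) (by omega) (by omega) (by omega)
      rw [show -(y₂ + W) + W = -y₂ by ring, show -(y₁ + W) + W = -y₁ by ring] at this
      simp only [neg_neg] at this
      omega

theorem exchange_diag_right (h : DistA f ℓ) (hf : Lip f) {V : ℤ} (hV : 0 < V) (hV2 : V % 2 = 0)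
    (hE : Exchange V f) (i : ℤ) {y₁ y₂ : ℤ} (h0 : 0 ≤ y₁) (h12 : y₁ ≤ y₂) :
    ℓ (i + (y₁ + V)) (y₁ + V) + ℓ (i + y₂) y₂ ≤
      ℓ (i + y₁) y₁ + ℓ (i + (y₂ + V)) (y₂ + V) + 1 := by
  obtain ⟨p, p1, p2, p3⟩ := h.exists_window hf (x := i + y₁) (y := y₁) h0
  obtain ⟨q, q1, q2, q3⟩ := h.exists_window hf (x := i + (y₂ + V)) (y := y₂ + V) (by omega)
  by_cases hq : q ≤ i + y₂
  · have a1 := h.le_window (x := i + (y₁ + V)) (y := y₁ + V) (p := p) (by omega) (by omega)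
    have a2 := h.le_window (x := i + y₂) (y := y₂) (p := q) (by omega) (by omega)
    omega
  by_cases hpq : p ≤ q - V
  · have e := hE.apply (x := p) (y := q - V) (x' := p + V) (y' := q) (by omega) rfl (by omega)
    have a1 := h.le_window (x := i + (y₁ + V)) (y := y₁ + V) (p := p + V) (by omega) (by omega)
    have a2 := h.le_window (x := i + y₂) (y := y₂) (p := q - V) (by omega) (by omega)
    omega
  · have a1 := h.le_window (x := i + (y₁ + V)) (y := y₁ + V) (p := q) (by omega) (by omega)
    have a2 := h.le_window (x := i + y₂) (y := y₂) (p := p) (by omega) (by omega)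
    omega

theorem mono_diag (h : DistA f ℓ) (hf : Lip f) (i : ℤ) {y₁ y₂ : ℤ} (h0 : 0 ≤ y₁)
    (h12 : y₁ ≤ y₂) : ℓ (i + y₁) y₁ ≤ ℓ (i + y₂) y₂ := by
  obtain ⟨q, q1, q2, q3⟩ := h.exists_window hf (x := i + y₂) (y := y₂) (by omega)
  by_cases hq : q ≤ i + y₁
  · have a1 := h.le_window (x := i + y₁) (y := y₁) (p := q) (by omega) (by omega)
    omega
  · have a1 := h.le_window (x := i + y₁) (y := y₁) (p := i + y₁) (by omega) (by omega)
    have a2 := hf (i + y₁) q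
    omega

theorem exchange_diag (h : DistA f ℓ) (hf : Lip f) {V : ℤ} (hV : 0 < V) (hV2 : V % 2 = 0)
    (hE : Exchange V f) (i : ℤ) : Exchange V fun y => ℓ (i + y) y := by
  refine Exchange.of_glue (c := 0) hV.le (fun _ _ => h.mono_diag hf i) ?_
    (fun _ _ => h.exchange_diag_right hf hV hV2 hE i) ?_
  · intro y₁ y₂ h12 h2
    have := h.neg.mono_diag hf.comp_neg (-i) (y₁ := -y₂) (y₂ := -y₁) (by omega) (by omega)
    rw [show -i + -y₂ = -(i + y₂) by ring, show -i + -y₁ = -(i + y₁) by ring] at this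
    simpa only [neg_neg] using this
  · intro y₁ y₂ h12 h2
    have := h.neg.exchange_diag_right hf.comp_neg hV hV2 hE.comp_neg (-i) (y₁ := -(y₂ + V))
      (y₂ := -(y₁ + V)) (by omega) (by omega)
    rw [show -(y₂ + V) + V = -y₂ by ring, show -(y₁ + V) + V = -y₁ by ring] at this
    simp only [show ∀ t, -i + -t = -(i + t) from fun t => by ring, neg_neg] at this
    omega

/-- One step on a `d`-line is two diagonal steps and moves an end of the window by two feet, so the
scale doubles. -/
theorem exchange_d (h : DistA f ℓ) (hf : Lip f) {W : ℤ} (hW : 0 < W)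
    (hE : Exchange (2 * W) f) (x y : ℤ) : Exchange W fun k => ℓ (x + 2 * k) (y + 2 * k) := by
  intro k l hkl
  have := (h.exchange_diag hf (V := 2 * W) (by omega) (by omega) hE (x - y)).apply
    (x := y + 2 * k) (y := y + 2 * l) (x' := y + 2 * (k + W)) (y' := y + 2 * (l + W))
    (by omega) (by omega) (by omega)
  simp only [show ∀ t, x - y + (y + 2 * t) = x + 2 * t from fun t => by ring] at this
  exact this

end DistA

theorem norm_le_add (x y x' y' : ℤ) : norm x y ≤ norm x' y' + norm (x - x') (y - y') := by
  unfold norm; omega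

theorem norm_nonneg (x y : ℤ) : 0 ≤ norm x y := by
  unfold norm; omega

theorem DistD.le_add {f : ℤ → ℤ} {ℓ : ℤ → ℤ → ℤ} (h : DistD f ℓ) (x y x' y' : ℤ) :
    ℓ x y ≤ ℓ x' y' + norm (x - x') (y - y') := by
  obtain ⟨k, hk⟩ := h.exists_eq x' y'
  have h1 := h.le x y k
  have h2 := norm_le_add (x - 2 * k) (y - 2 * k) (x' - 2 * k) (y' - 2 * k)
  rw [show x - 2 * k - (x' - 2 * k) = x - x' by ring,
    show y - 2 * k - (y' - 2 * k) = y - y' by ring] at h2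
  omega

theorem DistA.le_add {f : ℤ → ℤ} {ℓ : ℤ → ℤ → ℤ} (h : DistA f ℓ) (x y x' y' : ℤ) :
    ℓ x y ≤ ℓ x' y' + norm (x - x') (y - y') := by
  obtain ⟨k, hk⟩ := h.exists_eq x' y'
  have h1 := h.le x y k
  have h2 := norm_le_add (x - k) y (x' - k) y'
  rw [show x - k - (x' - k) = x - x' by ring] at h2
  omega

/-! ### The three directions treated uniformly -/

/-- The directions of the lines along which sheets are glued. -/
inductive Dir
  | a | b | d
  deriving DecidableEq

/-- The coordinates of the direction. -/
def Dir.vec : Dir → ℤ × ℤ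
  | .a => (1, 0)
  | .b => (0, 1)
  | .d => (2, 2)

/-- `ℓ` is the distance function on a sheet whose entry line has direction `u` and distances
`f`. -/
structure IsDist (u : Dir) (f : ℤ → ℤ) (ℓ : ℤ × ℤ → ℤ) : Prop where
  exists_eq : ∀ z, ∃ k, ℓ z = f k + norm (z.1 - k * u.vec.1) (z.2 - k * u.vec.2)
  le : ∀ z k, ℓ z ≤ f k + norm (z.1 - k * u.vec.1) (z.2 - k * u.vec.2)

theorem IsDist.distD {f : ℤ → ℤ} {ℓ : ℤ × ℤ → ℤ} (h : IsDist .d f ℓ) :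
    DistD f fun x y => ℓ (x, y) := by
  refine ⟨fun x y => ?_, fun x y k => ?_⟩
  · simpa [Dir.vec, mul_comm] using h.exists_eq (x, y)
  · simpa [Dir.vec, mul_comm] using h.le (x, y) k

theorem IsDist.distA {f : ℤ → ℤ} {ℓ : ℤ × ℤ → ℤ} (h : IsDist .a f ℓ) :
    DistA f fun x y => ℓ (x, y) := by
  refine ⟨fun x y => ?_, fun x y k => ?_⟩
  · simpa [Dir.vec] using h.exists_eq (x, y)
  · simpa [Dir.vec] using h.le (x, y) k

theorem norm_swap (x y : ℤ) : norm y x = norm x y := by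
  unfold norm; omega

theorem IsDist.distB {f : ℤ → ℤ} {ℓ : ℤ × ℤ → ℤ} (h : IsDist .b f ℓ) :
    DistA f fun x y => ℓ (y, x) := by
  refine ⟨fun x y => ?_, fun x y k => ?_⟩
  · simpa [Dir.vec, norm_swap] using h.exists_eq (y, x)
  · simpa [Dir.vec, norm_swap] using h.le (y, x) k

theorem IsDist.le_add {u : Dir} {f : ℤ → ℤ} {ℓ : ℤ × ℤ → ℤ} (h : IsDist u f ℓ) (z z' : ℤ × ℤ) :
    ℓ z ≤ ℓ z' + norm (z.1 - z'.1) (z.2 - z'.2) := by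
  cases u
  · exact h.distA.le_add _ _ _ _
  · rw [← norm_swap]; exact h.distB.le_add z.2 z.1 z'.2 z'.1
  · exact h.distD.le_add _ _ _ _

/-- On every line with one of the three directions the distances are dyadically convex. -/
theorem IsDist.dyadicConvex {u : Dir} {f : ℤ → ℤ} {ℓ : ℤ × ℤ → ℤ} (h : IsDist u f ℓ)
    (hf : DyadicConvex f) (v : Dir) (z : ℤ × ℤ) :
    DyadicConvex fun k => ℓ (z + k • v.vec) := by
  have pow_pos' : ∀ n : ℕ, (0 : ℤ) < 2 ^ n := fun n => by positivity
  refine ⟨Lip.of_succ fun k => ?_, fun n => ?_⟩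
  · have h1 := h.le_add (z + (k + 1) • v.vec) (z + k • v.vec)
    have h2 := h.le_add (z + k • v.vec) (z + (k + 1) • v.vec)
    have h3 : z + (k + 1) • v.vec - (z + k • v.vec) = v.vec := by rw [add_smul, one_smul]; abel
    have h4 : z + k • v.vec - (z + (k + 1) • v.vec) = -v.vec := by rw [add_smul, one_smul]; abel
    rw [← Prod.fst_sub, ← Prod.snd_sub, h3] at h1
    rw [← Prod.fst_sub, ← Prod.snd_sub, h4] at h2
    have h5 : norm v.vec.1 v.vec.2 = 1 ∧ norm (-v.vec).1 (-v.vec).2 = 1 := by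
      cases v <;> decide
    omega
  · obtain ⟨x, y⟩ := z
    have hp := pow_pos' n
    have hE := hf.exchange n
    have hE1 : Exchange (2 * (2 * 2 ^ n)) f := by
      have := hf.exchange (n + 1)
      rwa [pow_succ, mul_comm (2 ^ n : ℤ)] at this
    -- The halved scale, for passing from a `d`-line to an `a`- or `b`-line; `hE1` is the doubled
    -- scale for the converse.
    have hE0 : (2 ^ n : ℤ) = 1 ∨ Exchange (2 ^ n) f := by
      cases n with
      | zero => left; simp
      | succ m => right; have := hf.exchange m; rwa [pow_succ, mul_comm (2 ^ m : ℤ)]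
    cases u <;> cases v <;> simp only [Dir.vec, Prod.smul_mk, Prod.mk_add_mk, smul_eq_mul,
      mul_one, mul_zero, add_zero, mul_comm _ (2 : ℤ)]
    · exact (h.distA.exchange_a hf.lip hE y).comp_add x
    · exact (h.distA.exchange_b hf.lip (by omega) (by omega) hE x).comp_add y
    · exact h.distA.exchange_d hf.lip (by omega) hE1 x y
    · exact (h.distB.exchange_b hf.lip (by omega) (by omega) hE y).comp_add x
    · exact (h.distB.exchange_a hf.lip hE x).comp_add y
    · exact h.distB.exchange_d hf.lip (by omega) hE1 y x
    · exact (h.distD.exchange_a hf.lip hp hE0 y).comp_add x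
    · exact (h.distD.swap.exchange_a hf.lip hp hE0 x).comp_add y
    · exact h.distD.exchange_d hf.lip hE x y

/-! ### Paths inside the ball: within one sheet -/

section Linked
variable {V : Type*}

/-- `u` and `v` are joined by a path of length at most `n` through vertices of level at most `N`
which has no edge with both endpoints of level `N`. -/
def Linked (Γ : SimpleGraph V) (lev : V → ℤ) (N n : ℤ) (u v : V) : Prop :=
  ∃ p : Γ.Walk u v, p.length ≤ n ∧ (∀ w ∈ p.support, lev w ≤ N) ∧
    ∀ e ∈ p.darts, ¬ (lev e.fst = N ∧ lev e.snd = N)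

variable {Γ : SimpleGraph V} {lev : V → ℤ} {N m n : ℤ} {u v w : V}

theorem Linked.refl (hn : 0 ≤ n) (hu : lev u ≤ N) : Linked Γ lev N n u u :=
  ⟨.nil, by simpa, by simpa, by simp⟩

theorem Linked.trans (h₁ : Linked Γ lev N m u v) (h₂ : Linked Γ lev N n v w) :
    Linked Γ lev N (m + n) u w := by
  obtain ⟨p, p1, p2, p3⟩ := h₁
  obtain ⟨q, q1, q2, q3⟩ := h₂
  refine ⟨p.append q, by rw [SimpleGraph.Walk.length_append]; omega, fun x hx => ?_,
    fun e he => ?_⟩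
  · rw [SimpleGraph.Walk.mem_support_append_iff] at hx
    exact hx.elim (p2 x) (q2 x)
  · rw [SimpleGraph.Walk.darts_append, List.mem_append] at he
    exact he.elim (p3 e) (q3 e)

theorem Linked.symm (h : Linked Γ lev N n u v) : Linked Γ lev N n v u := by
  obtain ⟨p, p1, p2, p3⟩ := h
  refine ⟨p.reverse, by simpa, by simpa, fun e he => ?_⟩
  rw [SimpleGraph.Walk.mem_darts_reverse] at he
  have := p3 _ he
  rwa [and_comm] at this

theorem Linked.mono (h : Linked Γ lev N m u v) (hmn : m ≤ n) : Linked Γ lev N n u v := by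
  obtain ⟨p, p1, p2⟩ := h
  exact ⟨p, p1.trans hmn, p2⟩

theorem Linked.of_adj (h : Γ.Adj u v) (hu : lev u ≤ N) (hv : lev v ≤ N)
    (huv : ¬ (lev u = N ∧ lev v = N)) : Linked Γ lev N 1 u v :=
  ⟨.cons h .nil, by simp, by simp [hu, hv], by simpa using huv⟩

end Linked

/-- Take the nearest values `≤ N` on either side. Two steps inward from each, the values are at
least `N + 1`, and exchange would give `2N + 2 ≤ 2N + 1`. -/
theorem Exchange.not_both_gt {f : ℤ → ℤ} (h : Exchange 2 f) {p q i N : ℤ} (hp : f p ≤ N)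
    (hq : f q ≤ N) (hpi : p ≤ i) (hiq : i + 1 ≤ q) : f i ≤ N ∨ f (i + 1) ≤ N := by
  by_contra! hi
  obtain ⟨hi1, hi2⟩ := hi
  obtain ⟨p', ⟨p1, p2⟩, p3⟩ := Int.exists_greatest_of_bdd (P := fun z => f z ≤ N ∧ z ≤ i)
    ⟨i, fun z hz => hz.2⟩ ⟨p, hp, hpi⟩
  obtain ⟨q', ⟨q1, q2⟩, q3⟩ := Int.exists_least_of_bdd (P := fun z => f z ≤ N ∧ i + 1 ≤ z)
    ⟨i + 1, fun z hz => hz.2⟩ ⟨q, hq, hiq⟩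
  have hp' : p' ≠ i := by rintro rfl; omega
  have hq' : q' ≠ i + 1 := by rintro rfl; omega
  have key : ∀ z, p' < z → z < q' → N < f z := by
    intro z hz1 hz2
    by_contra! hz
    rcases le_or_gt z i with h1 | h1
    · have := p3 z ⟨hz, h1⟩; omega
    · have := q3 z ⟨hz, h1⟩; omega
  have e := h.apply (x := p') (y := q' - 2) (x' := p' + 2) (y' := q') (by omega) rfl (by omega)
  have e1 := key (p' + 2) (by omega) (by omega)
  have e2 := key (q' - 2) (by omega) (by omega)
  omega

/-- On a parity class `2 f z + z` has constant parity, so a value exceeding the maximum exceeds it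
by at least two; this beats the doubled error in the exchange inequality. -/
theorem Exchange.slope_le_max {f : ℤ → ℤ} (h : Exchange 2 f) {p q i : ℤ}
    (hpi : p ≤ i) (hiq : i ≤ q) (h1 : p % 2 = i % 2) (h2 : i % 2 = q % 2) :
    2 * f i + i ≤ max (2 * f p + p) (2 * f q + q) := by
  by_contra! hi
  set N := max (2 * f p + p) (2 * f q + q) with hN
  obtain ⟨p', ⟨p1, p2, p4⟩, p3⟩ := Int.exists_greatest_of_bdd
    (P := fun z => 2 * f z + z ≤ N ∧ z ≤ i ∧ z % 2 = i % 2)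
    ⟨i, fun z hz => hz.2.1⟩ ⟨p, by omega, hpi, h1⟩
  obtain ⟨q', ⟨q1, q2, q4⟩, q3⟩ := Int.exists_least_of_bdd
    (P := fun z => 2 * f z + z ≤ N ∧ i ≤ z ∧ z % 2 = i % 2)
    ⟨i, fun z hz => hz.2.1⟩ ⟨q, by omega, hiq, h2.symm⟩
  have hp' : p' ≠ i := by rintro rfl; omega
  have hq' : q' ≠ i := by rintro rfl; omega
  have e := h.apply (x := p') (y := q' - 2) (x' := p' + 2) (y' := q') (by omega) rfl (by omega)
  have e1 := fun hh => p3 (p' + 2) ⟨hh, by omega, by omega⟩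
  have e2 := fun hh => q3 (q' - 2) ⟨hh, by omega, by omega⟩
  omega

theorem exists_norm_step {x y : ℤ} (h : 0 < norm x y) :
    ∃ i j, norm i j = 1 ∧ norm (x - i) (y - j) = norm x y - 1 := by
  by_cases h1 : y < x
  · by_cases h2 : 0 < x
    · exact ⟨1, 0, by decide, by unfold norm at *; omega⟩
    · exact ⟨0, -1, by decide, by unfold norm at *; omega⟩
  · by_cases h2 : x < y
    · by_cases h3 : 0 < y
      · exact ⟨0, 1, by decide, by unfold norm at *; omega⟩
      · exact ⟨-1, 0, by decide, by unfold norm at *; omega⟩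
    · by_cases h3 : 0 < x
      · by_cases h4 : x = 1
        · exact ⟨1, 1, by decide, by unfold norm at *; omega⟩
        · exact ⟨2, 2, by decide, by unfold norm at *; omega⟩
      · by_cases h4 : x = -1
        · exact ⟨-1, -1, by decide, by unfold norm at *; omega⟩
        · exact ⟨-2, -2, by decide, by unfold norm at *; omega⟩

section Sheet
variable {V : Type*} {Γ : SimpleGraph V} {lev : V → ℤ} {φ : ℤ → ℤ → V} {f : ℤ → ℤ}

/-- A geodesic of the sheet works: a vertex with `r` steps left has level at most the final level
plus `r`, so only the first vertex can have level `N`. -/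
theorem linked_of_level_add_norm_le
    (hΓ : ∀ x y i j, norm i j = 1 → Γ.Adj (φ x y) (φ (x + i) (y + j)))
    (hlev : ∀ x y x' y', lev (φ x y) ≤ lev (φ x' y') + norm (x - x') (y - y'))
    {N x y x' y' : ℤ} (h : lev (φ x' y') + norm (x - x') (y - y') ≤ N) :
    Linked Γ lev N (norm (x - x') (y - y')) (φ x y) (φ x' y') := by
  obtain ⟨n, hn⟩ : ∃ n : ℕ, norm (x - x') (y - y') = n :=
    ⟨(norm (x - x') (y - y')).toNat, by have := norm_nonneg (x - x') (y - y'); omega⟩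
  induction n generalizing x y with
  | zero =>
    obtain ⟨rfl, rfl⟩ : x = x' ∧ y = y' := by unfold norm at hn; omega
    exact Linked.refl (norm_nonneg _ _) (by have := norm_nonneg (x - x) (y - y); omega)
  | succ n ih =>
    obtain ⟨i, j, h1, h2⟩ := exists_norm_step (x := x - x') (y := y - y') (by omega)
    rw [show x - x' - i = x - i - x' by ring, show y - y' - j = y - j - y' by ring] at h2
    have h3 := ih (x := x - i) (y := y - j) (by omega) (by omega)
    have h4 := hlev (x - i) (y - j) x' y'
    have h5 := hlev x y x' y'
    have h6 := hΓ (x - i) (y - j) i j h1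
    rw [sub_add_cancel, sub_add_cancel] at h6
    exact ((Linked.of_adj h6.symm (by omega) (by omega) (by omega)).trans h3).mono (by omega)

variable {ℓ : ℤ → ℤ → ℤ}

theorem linked_of_common_descent
    (hΓ : ∀ x y i j, norm i j = 1 → Γ.Adj (φ x y) (φ (x + i) (y + j)))
    (hlev : ∀ x y x' y', lev (φ x y) ≤ lev (φ x' y') + norm (x - x') (y - y'))
    {N x y x' y' : ℤ} (i j : ℤ) (hn : norm (x - x') (y - y') ≤ 2) (hij : norm i j = 2)
    (h : lev (φ (x - i) (y - j)) ≤ N - 2) (h' : lev (φ (x' - i) (y' - j)) ≤ N - 2) :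
    Linked Γ lev N 6 (φ x y) (φ x' y') := by
  have e1 := linked_of_level_add_norm_le hΓ hlev (N := N) (x := x) (y := y) (x' := x - i)
    (y' := y - j) (by rw [sub_sub_cancel, sub_sub_cancel]; omega)
  have e2 := linked_of_level_add_norm_le hΓ hlev (N := N) (x := x - i) (y := y - j) (x' := x' - i)
    (y' := y' - j) (by rw [sub_sub_sub_cancel_right, sub_sub_sub_cancel_right]; omega)
  have e3 := linked_of_level_add_norm_le hΓ hlev (N := N) (x := x') (y := y') (x' := x' - i)
    (y' := y' - j) (by rw [sub_sub_cancel, sub_sub_cancel]; omega)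
  rw [sub_sub_cancel, sub_sub_cancel] at e1 e3
  rw [sub_sub_sub_cancel_right, sub_sub_sub_cancel_right] at e2
  exact ((e1.trans e2).trans e3.symm).mono (by omega)

/-- The descent `(2,0)` keeps a foot unless it is near the right end of the window, and `(0,-2)`
unless it is near the left end. If the two points demand different descents, `Exchange.not_both_gt`
finds a foot in the middle that is no worse than the worse of the two; that point may then follow
the other. -/
theorem DistD.linked_of_far (h : DistD f ℓ) (hf : DyadicConvex f)
    (hΓ : ∀ x y i j, norm i j = 1 → Γ.Adj (φ x y) (φ (x + i) (y + j)))
    (hℓ : ∀ x y, lev (φ x y) = ℓ x y)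
    {N x y x' y' : ℤ} (hn : norm (x - x') (y - y') ≤ 2)
    (hN : ℓ x y ≤ N) (hN' : ℓ x' y' ≤ N) (hxy : y + 30 < x) :
    Linked Γ lev N 6 (φ x y) (φ x' y') := by
  have hlev : ∀ x y x' y', lev (φ x y) ≤ lev (φ x' y') + norm (x - x') (y - y') := by
    intro x y x' y'; rw [hℓ, hℓ]; exact h.le_add x y x' y'
  have hd : x - x' ≤ 4 ∧ x' - x ≤ 4 ∧ y - y' ≤ 4 ∧ y' - y ≤ 4 := by unfold norm at hn; omega
  obtain ⟨k, hk⟩ := h.exists_window hf.lip (x := x) (y := y) (by omega)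
  obtain ⟨k', hk'⟩ := h.exists_window hf.lip (x := x') (y := y') (by omega)
  replace hk : y ≤ 2 * k ∧ 2 * k ≤ x ∧ ℓ x y = x - y + f k := by omega
  replace hk' : y' ≤ 2 * k' ∧ 2 * k' ≤ x' ∧ ℓ x' y' = x' - y' + f k' := by omega
  have hE : Exchange 2 f := by simpa using hf.exchange 0
  have right : ∀ l l', y ≤ 2 * l → 2 * l ≤ x - 2 → f l ≤ f k → y' ≤ 2 * l' → 2 * l' ≤ x' - 2 →
      f l' ≤ f k' → Linked Γ lev N 6 (φ x y) (φ x' y') := by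
    intro l l' l1 l2 l3 l1' l2' l3'
    have a1 := h.le_window (x := x - 2) (y := y) l1 (by omega)
    have a2 := h.le_window (x := x' - 2) (y := y') l1' (by omega)
    exact linked_of_common_descent hΓ hlev 2 0 hn (by decide) (by simp only [hℓ, sub_zero]; omega)
      (by simp only [hℓ, sub_zero]; omega)
  have left : ∀ l l', y + 2 ≤ 2 * l → 2 * l ≤ x → f l ≤ f k → y' + 2 ≤ 2 * l' → 2 * l' ≤ x' →
      f l' ≤ f k' → Linked Γ lev N 6 (φ x y) (φ x' y') := by
    intro l l' l1 l2 l3 l1' l2' l3'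
    have a1 := h.le_window (x := x) (y := y + 2) (k := l) (by omega) (by omega)
    have a2 := h.le_window (x := x') (y := y' + 2) (k := l') (by omega) (by omega)
    exact linked_of_common_descent hΓ hlev 0 (-2) hn (by decide)
      (by simp only [hℓ, sub_zero, sub_neg_eq_add]; omega)
      (by simp only [hℓ, sub_zero, sub_neg_eq_add]; omega)
  by_cases h1 : 2 * k ≤ x - 2 ∧ 2 * k' ≤ x' - 2
  · exact right k k' (by omega) (by omega) (by omega) (by omega) (by omega) (by omega)
  by_cases h2 : y + 2 ≤ 2 * k ∧ y' + 2 ≤ 2 * k'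
  · exact left k k' (by omega) (by omega) (by omega) (by omega) (by omega) (by omega)
  have mid : ∃ j, y + 8 ≤ 2 * j ∧ 2 * j ≤ x - 8 ∧ f j ≤ max (f k) (f k') := by
    rcases le_total k k' with hkk | hkk
    · rcases hE.not_both_gt (p := k) (q := k') (i := (x + y) / 4) (N := max (f k) (f k'))
        (by omega) (by omega) (by omega) (by omega) with hj | hj
      · exact ⟨_, by omega, by omega, hj⟩
      · exact ⟨_, by omega, by omega, hj⟩
    · rcases hE.not_both_gt (p := k') (q := k) (i := (x + y) / 4) (N := max (f k) (f k'))
        (by omega) (by omega) (by omega) (by omega) with hj | hj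
      · exact ⟨_, by omega, by omega, hj⟩
      · exact ⟨_, by omega, by omega, hj⟩
  obtain ⟨j, j1, j2, j3⟩ := mid
  rcases le_total (f k) (f k') with hff | hff
  · by_cases h3 : 2 * k ≤ x - 2
    · exact right k j (by omega) (by omega) (by omega) (by omega) (by omega) (by omega)
    · exact left k j (by omega) (by omega) (by omega) (by omega) (by omega) (by omega)
  · by_cases h3 : 2 * k' ≤ x' - 2
    · exact right j k' (by omega) (by omega) (by omega) (by omega) (by omega) (by omega)
    · exact left j k' (by omega) (by omega) (by omega) (by omega) (by omega) (by omega)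

theorem DistD.linked (h : DistD f ℓ) (hf : DyadicConvex f)
    (hΓ : ∀ x y i j, norm i j = 1 → Γ.Adj (φ x y) (φ (x + i) (y + j)))
    (hℓ : ∀ x y, lev (φ x y) = ℓ x y)
    {N x y x' y' : ℤ} (hn : norm (x - x') (y - y') ≤ 2)
    (hline : ∀ p q, f p ≤ N → f q ≤ N →
      Linked Γ lev N (max (p - q) (q - p) + 2) (φ (2 * p) (2 * p)) (φ (2 * q) (2 * q)))
    (hN : ℓ x y ≤ N) (hN' : ℓ x' y' ≤ N) :
    Linked Γ lev N 200 (φ x y) (φ x' y') := by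
  have hlev : ∀ x y x' y', lev (φ x y) ≤ lev (φ x' y') + norm (x - x') (y - y') := by
    intro x y x' y'; rw [hℓ, hℓ]; exact h.le_add x y x' y'
  by_cases h1 : y + 30 < x
  · exact (h.linked_of_far hf hΓ hℓ hn hN hN' h1).mono (by norm_num)
  by_cases h2 : x + 30 < y
  · exact (h.swap.linked_of_far (φ := fun x y => φ y x) hf
      (fun x y i j hij => hΓ y x j i (by rwa [norm_swap]))
      (fun x y => hℓ y x) (by rwa [norm_swap]) hN hN' h2).mono (by norm_num)
  have hd : x - x' ≤ 4 ∧ x' - x ≤ 4 ∧ y - y' ≤ 4 ∧ y' - y ≤ 4 := by unfold norm at hn; omega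
  -- Near the entry line the feet are at bounded distance, so the path goes to a foot, along the
  -- entry line by `hline`, and back. The numerical bounds are generous; `200` also covers the case
  -- of `DistA`.
  have foot : ∀ x y, x ≤ y + 40 → y ≤ x + 40 →
      ∃ k, ℓ x y = f k + norm (x - 2 * k) (y - 2 * k) ∧ norm (x - 2 * k) (y - 2 * k) ≤ 40 ∧
        2 * k ≤ x + 42 ∧ x ≤ 2 * k + 42 := by
    intro x y hx hy
    rcases le_total y x with hxy | hxy
    · obtain ⟨k, hk⟩ := h.exists_window hf.lip hxy
      exact ⟨k, by unfold norm; omega, by unfold norm; omega, by omega, by omega⟩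
    · obtain ⟨k, hk⟩ := h.swap.exists_window hf.lip hxy
      exact ⟨k, by unfold norm; omega, by unfold norm; omega, by omega, by omega⟩
  obtain ⟨k, k1, k2, k3, k4⟩ := foot x y (by omega) (by omega)
  obtain ⟨k', k1', k2', k3', k4'⟩ := foot x' y' (by omega) (by omega)
  have n1 := norm_nonneg (x - 2 * k) (y - 2 * k)
  have n2 := norm_nonneg (x' - 2 * k') (y' - 2 * k')
  have b1 : lev (φ (2 * k) (2 * k)) ≤ f k := by
    rw [hℓ]; have := h.le_window (x := 2 * k) (y := 2 * k) (k := k) le_rfl le_rfl; omega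
  have b2 : lev (φ (2 * k') (2 * k')) ≤ f k' := by
    rw [hℓ]; have := h.le_window (x := 2 * k') (y := 2 * k') (k := k') le_rfl le_rfl; omega
  have e1 := linked_of_level_add_norm_le hΓ hlev (N := N) (x := x) (y := y) (x' := 2 * k)
    (y' := 2 * k) (by omega)
  have e2 := linked_of_level_add_norm_le hΓ hlev (N := N) (x := x') (y := y') (x' := 2 * k')
    (y' := 2 * k') (by omega)
  exact ((e1.trans (hline k k' (by omega) (by omega))).trans e2.symm).mono (by omega)

/-- The cost of a foot `p` is governed by `2 f p + p`, so the middle foot comes from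
`Exchange.slope_le_max`. The descents are two `d`-steps, `(4,4)`, or two `b`-steps, `(0,2)`. -/
theorem DistA.linked_of_far (h : DistA f ℓ) (hf : DyadicConvex f)
    (hΓ : ∀ x y i j, norm i j = 1 → Γ.Adj (φ x y) (φ (x + i) (y + j)))
    (hℓ : ∀ x y, lev (φ x y) = ℓ x y)
    {N x y x' y' : ℤ} (hn : norm (x - x') (y - y') ≤ 2)
    (hN : ℓ x y ≤ N) (hN' : ℓ x' y' ≤ N) (hy : 40 < y) :
    Linked Γ lev N 6 (φ x y) (φ x' y') := by
  have hlev : ∀ x y x' y', lev (φ x y) ≤ lev (φ x' y') + norm (x - x') (y - y') := by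
    intro x y x' y'; rw [hℓ, hℓ]; exact h.le_add x y x' y'
  have hd : x - x' ≤ 4 ∧ x' - x ≤ 4 ∧ y - y' ≤ 4 ∧ y' - y ≤ 4 := by unfold norm at hn; omega
  obtain ⟨p, p1, p2, p3⟩ := h.exists_window hf.lip (x := x) (y := y) (by omega)
  obtain ⟨p', p1', p2', p3'⟩ := h.exists_window hf.lip (x := x') (y := y') (by omega)
  have hE : Exchange 2 f := by simpa using hf.exchange 0
  have right : ∀ l l', x - y ≤ l → l ≤ x - 4 → f l - (x - l) / 2 ≤ f p - (x - p) / 2 →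
      x' - y' ≤ l' → l' ≤ x' - 4 → f l' - (x' - l') / 2 ≤ f p' - (x' - p') / 2 →
      Linked Γ lev N 6 (φ x y) (φ x' y') := by
    intro l l' l1 l2 l3 l1' l2' l3'
    have a1 := h.le_window (x := x - 4) (y := y - 4) (p := l) (by omega) (by omega)
    have a2 := h.le_window (x := x' - 4) (y := y' - 4) (p := l') (by omega) (by omega)
    exact linked_of_common_descent hΓ hlev 4 4 hn (by decide) (by rw [hℓ]; omega)
      (by rw [hℓ]; omega)
  have left : ∀ l l', x - y + 2 ≤ l → l ≤ x → f l - (x - l) / 2 ≤ f p - (x - p) / 2 →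
      x' - y' + 2 ≤ l' → l' ≤ x' → f l' - (x' - l') / 2 ≤ f p' - (x' - p') / 2 →
      Linked Γ lev N 6 (φ x y) (φ x' y') := by
    intro l l' l1 l2 l3 l1' l2' l3'
    have a1 := h.le_window (x := x) (y := y - 2) (p := l) (by omega) (by omega)
    have a2 := h.le_window (x := x') (y := y' - 2) (p := l') (by omega) (by omega)
    exact linked_of_common_descent hΓ hlev 0 2 hn (by decide)
      (by rw [hℓ, sub_zero]; omega) (by rw [hℓ, sub_zero]; omega)
  by_cases h1 : p ≤ x - 4 ∧ p' ≤ x' - 4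
  · exact right p p' (by omega) (by omega) (by omega) (by omega) (by omega) (by omega)
  by_cases h2 : x - y + 2 ≤ p ∧ x' - y' + 2 ≤ p'
  · exact left p p' (by omega) (by omega) (by omega) (by omega) (by omega) (by omega)
  have mid : ∀ q q', q ≤ x - y + 10 → x - 10 ≤ q' → q ≤ q' →
      (∃ j, x - y + 10 ≤ j ∧ j ≤ x - 10 ∧ j % 2 = q % 2 ∧ 2 * f j + j ≤ 2 * f q + q) ∨
      (∃ j, x - y + 10 ≤ j ∧ j ≤ x - 10 ∧ j % 2 = q' % 2 ∧ 2 * f j + j ≤ 2 * f q' + q') := by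
    intro q q' hq hq' hqq
    obtain ⟨i, i1, i2, i3⟩ : ∃ i, x - y + 11 ≤ i ∧ i ≤ x - 11 ∧ i % 2 = q % 2 := by
      by_cases hpar : (x - 12) % 2 = q % 2
      · exact ⟨x - 12, by omega, by omega, hpar⟩
      · exact ⟨x - 13, by omega, by omega, by omega⟩
    by_cases hpar : q % 2 = q' % 2
    · have := hE.slope_le_max (p := q) (q := q') (i := i) (by omega) (by omega) (by omega)
        (by omega)
      rcases le_total (2 * f q + q) (2 * f q' + q') with hle | hle
      · exact Or.inr ⟨i, by omega, by omega, by omega, by omega⟩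
      · exact Or.inl ⟨i, by omega, by omega, by omega, by omega⟩
    -- Passing to the left neighbour of a foot raises `2 f z + z` by at most `1`. The values at `q`
    -- and `q'` have different parities, hence differ, and the gap absorbs this loss.
    · have e1 := hE.slope_le_max (p := q) (q := q' - 1) (i := i) (by omega) (by omega) (by omega)
        (by omega)
      have e2 := hE.slope_le_max (p := q - 1) (q := q') (i := i + 1) (by omega) (by omega)
        (by omega) (by omega)
      have e3 := hf.lip (q' - 1) q'
      have e4 := hf.lip (q - 1) q
      rcases le_total (2 * f q + q) (2 * f q' + q') with hle | hle
      · exact Or.inr ⟨i + 1, by omega, by omega, by omega, by omega⟩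
      · exact Or.inl ⟨i, by omega, by omega, by omega, by omega⟩
  rcases le_total p p' with hpp | hpp
  · rcases mid p p' (by omega) (by omega) hpp with ⟨j, j1, j2, j3, j4⟩ | ⟨j, j1, j2, j3, j4⟩
    · exact left j p' (by omega) (by omega) (by omega) (by omega) (by omega) (by omega)
    · exact right p j (by omega) (by omega) (by omega) (by omega) (by omega) (by omega)
  · rcases mid p' p (by omega) (by omega) hpp with ⟨j, j1, j2, j3, j4⟩ | ⟨j, j1, j2, j3, j4⟩
    · exact left p j (by omega) (by omega) (by omega) (by omega) (by omega) (by omega)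
    · exact right j p' (by omega) (by omega) (by omega) (by omega) (by omega) (by omega)

theorem DistA.linked (h : DistA f ℓ) (hf : DyadicConvex f)
    (hΓ : ∀ x y i j, norm i j = 1 → Γ.Adj (φ x y) (φ (x + i) (y + j)))
    (hℓ : ∀ x y, lev (φ x y) = ℓ x y)
    {N x y x' y' : ℤ} (hn : norm (x - x') (y - y') ≤ 2)
    (hline : ∀ p q, f p ≤ N → f q ≤ N →
      Linked Γ lev N (max (p - q) (q - p) + 2) (φ p 0) (φ q 0))
    (hN : ℓ x y ≤ N) (hN' : ℓ x' y' ≤ N) :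
    Linked Γ lev N 200 (φ x y) (φ x' y') := by
  have hlev : ∀ x y x' y', lev (φ x y) ≤ lev (φ x' y') + norm (x - x') (y - y') := by
    intro x y x' y'; rw [hℓ, hℓ]; exact h.le_add x y x' y'
  by_cases h1 : 40 < y
  · exact (h.linked_of_far hf hΓ hℓ hn hN hN' h1).mono (by norm_num)
  by_cases h2 : y < -40
  · have hf' : DyadicConvex fun k => f (-k) := ⟨hf.lip.comp_neg, fun n => (hf.exchange n).comp_neg⟩
    have := h.neg.linked_of_far (φ := fun x y => φ (-x) (-y)) (Γ := Γ) (lev := lev) (N := N)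
      (x := -x) (y := -y) (x' := -x') (y' := -y') hf'
      (fun x y i j hij => by
        have := hΓ (-x) (-y) (-i) (-j) (by unfold norm at *; omega)
        rwa [← neg_add, ← neg_add] at this)
      (fun x y => hℓ _ _) (by unfold norm at *; omega) (by simpa using hN) (by simpa using hN')
      (by omega)
    simp only [neg_neg] at this
    exact this.mono (by norm_num)
  have hd : x - x' ≤ 4 ∧ x' - x ≤ 4 ∧ y - y' ≤ 4 ∧ y' - y ≤ 4 := by unfold norm at hn; omega
  have foot : ∀ x y, y ≤ 44 → -44 ≤ y →
      ∃ p, ℓ x y = f p + norm (x - p) y ∧ norm (x - p) y ≤ 44 ∧ p ≤ x + 44 ∧ x ≤ p + 44 := by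
    intro x y hx hy
    rcases le_total 0 y with hxy | hxy
    · obtain ⟨p, p1, p2, p3⟩ := h.exists_window hf.lip (x := x) hxy
      exact ⟨p, by unfold norm; omega, by unfold norm; omega, by omega, by omega⟩
    · obtain ⟨p, p1, p2, p3⟩ := h.exists_window_neg hf.lip (x := x) hxy
      exact ⟨p, by unfold norm; omega, by unfold norm; omega, by omega, by omega⟩
  obtain ⟨k, k1, k2, k3, k4⟩ := foot x y (by omega) (by omega)
  obtain ⟨k', k1', k2', k3', k4'⟩ := foot x' y' (by omega) (by omega)
  have n1 := norm_nonneg (x - k) y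
  have n2 := norm_nonneg (x' - k') y'
  have b1 : lev (φ k 0) ≤ f k := by
    rw [hℓ]; have := h.le_window (x := k) (y := 0) (p := k) (by omega) le_rfl; omega
  have b2 : lev (φ k' 0) ≤ f k' := by
    rw [hℓ]; have := h.le_window (x := k') (y := 0) (p := k') (by omega) le_rfl; omega
  have e1 := linked_of_level_add_norm_le hΓ hlev (N := N) (x := x) (y := y) (x' := k)
    (y' := 0) (by rw [sub_zero]; omega)
  have e2 := linked_of_level_add_norm_le hΓ hlev (N := N) (x := x') (y := y') (x' := k')
    (y' := 0) (by rw [sub_zero]; omega)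
  rw [sub_zero] at e1 e2
  exact ((e1.trans (hline k k' (by omega) (by omega))).trans e2.symm).mono (by omega)

end Sheet

theorem IsDist.linked {V : Type*} {Γ : SimpleGraph V} {lev : V → ℤ} {u : Dir} {f : ℤ → ℤ}
    {ℓ : ℤ × ℤ → ℤ} (h : IsDist u f ℓ) (hf : DyadicConvex f) {φ : ℤ × ℤ → V}
    (hΓ : ∀ z w : ℤ × ℤ, norm w.1 w.2 = 1 → Γ.Adj (φ z) (φ (z + w)))
    (hℓ : ∀ z, lev (φ z) = ℓ z) {N : ℤ} {z z' : ℤ × ℤ}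
    (hn : norm (z.1 - z'.1) (z.2 - z'.2) ≤ 2)
    (hline : ∀ p q : ℤ, f p ≤ N → f q ≤ N →
      Linked Γ lev N (max (p - q) (q - p) + 2) (φ (p • u.vec)) (φ (q • u.vec)))
    (hN : ℓ z ≤ N) (hN' : ℓ z' ≤ N) : Linked Γ lev N 200 (φ z) (φ z') := by
  cases u
  · exact h.distA.linked (φ := fun x y => φ (x, y)) hf (fun x y i j => hΓ (x, y) (i, j))
      (fun x y => hℓ (x, y)) hn (by simpa [Dir.vec] using hline) hN hN'
  · exact h.distB.linked (φ := fun x y => φ (y, x)) hf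
      (fun x y i j hij => hΓ (y, x) (j, i) (by rwa [norm_swap]))
      (fun x y => hℓ (y, x)) (by rwa [norm_swap]) (by simpa [Dir.vec] using hline) hN hN'
  · exact h.distD.linked (φ := fun x y => φ (x, y)) hf (fun x y i j => hΓ (x, y) (i, j))
      (fun x y => hℓ (x, y)) hn (by simpa [Dir.vec, mul_comm] using hline) hN hN'

/-! ### Paths inside the ball: between points of an entry line -/

section Line
variable {V : Type*} {Γ : SimpleGraph V} {lev : V → ℤ} {φ π : ℤ → V} {f : ℤ → ℤ} {N : ℤ}

theorem linked_of_path (hφ : ∀ k, Γ.Adj (φ k) (φ (k + 1))) {p q : ℤ} (hpq : p ≤ q)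
    (hle : ∀ i, p ≤ i → i ≤ q → lev (φ i) ≤ N)
    (hlt : ∀ i, p ≤ i → i + 1 ≤ q → lev (φ i) < N ∨ lev (φ (i + 1)) < N) :
    Linked Γ lev N (q - p) (φ p) (φ q) := by
  induction q, hpq using Int.leInduction with
  | base => exact Linked.refl (by omega) (hle p le_rfl le_rfl)
  | succ q hpq ih =>
    have h1 := ih (fun i h1 h2 => hle i h1 (by omega)) (fun i h1 h2 => hlt i h1 (by omega))
    have h2 := hlt q hpq le_rfl
    exact (h1.trans (Linked.of_adj (hφ q) (hle q hpq (by omega)) (hle _ (by omega) le_rfl)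
      (by omega))).mono (by omega)

/-- The line `π` across the strip is one level lower. Between `p` and `q`, `Exchange.not_both_gt`
and the Lipschitz property give `f ≤ N + 1` with no two consecutive values above `N`, so `π` stays
in the ball and has no edge on the sphere. -/
theorem linked_of_parallel (hf : Lip f) (hE : Exchange 2 f) (hφ : ∀ k, lev (φ k) = f k)
    (hπ : ∀ k, lev (π k) = f k - 1) (hφπ : ∀ k, Γ.Adj (φ k) (π k))
    (hππ : ∀ k, Γ.Adj (π k) (π (k + 1))) {p q : ℤ} (hp : f p ≤ N) (hq : f q ≤ N) :
    Linked Γ lev N (max (p - q) (q - p) + 2) (φ p) (φ q) := by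
  have main : ∀ p q, p ≤ q → f p ≤ N → f q ≤ N →
      Linked Γ lev N (max (p - q) (q - p) + 2) (φ p) (φ q) := by
    intro p q hpq hp hq
    have hlt : ∀ i, p ≤ i → i + 1 ≤ q → lev (π i) < N ∨ lev (π (i + 1)) < N := by
      intro i h1 h2
      have := hE.not_both_gt hp hq h1 h2
      rw [hπ, hπ]; omega
    have hle : ∀ i, p ≤ i → i ≤ q → lev (π i) ≤ N := by
      intro i h1 h2
      rw [hπ]
      by_cases h3 : i = q
      · subst h3; omega
      · have := hE.not_both_gt hp hq h1 (by omega : i + 1 ≤ q)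
        have := hf i (i + 1)
        omega
    have e1 : Linked Γ lev N 1 (φ p) (π p) :=
      Linked.of_adj (hφπ p) (by rw [hφ]; omega) (by rw [hπ]; omega) (by rw [hφ, hπ]; omega)
    have e2 : Linked Γ lev N 1 (φ q) (π q) :=
      Linked.of_adj (hφπ q) (by rw [hφ]; omega) (by rw [hπ]; omega) (by rw [hφ, hπ]; omega)
    exact ((e1.trans (linked_of_path hππ hpq hle hlt)).trans e2.symm).mono (by omega)
  rcases le_total p q with h | h
  · exact main p q h hp hq
  · exact (main q p h hq hp).symm.mono (by omega)

theorem linked_of_abs (hφ : ∀ k, lev (φ k) = max k (-k)) (hφφ : ∀ k, Γ.Adj (φ k) (φ (k + 1)))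
    {p q : ℤ} (hp : max p (-p) ≤ N) (hq : max q (-q) ≤ N) :
    Linked Γ lev N (max (p - q) (q - p) + 2) (φ p) (φ q) := by
  have main : ∀ p q, p ≤ q → max p (-p) ≤ N → max q (-q) ≤ N →
      Linked Γ lev N (max (p - q) (q - p) + 2) (φ p) (φ q) := by
    intro p q hpq hp hq
    exact (linked_of_path hφφ hpq (fun i _ _ => by rw [hφ]; omega)
      (fun i _ _ => by rw [hφ, hφ]; omega)).mono (by omega)
  rcases le_total p q with h | h
  · exact main p q h hp hq
  · exact (main q p h hq hp).symm.mono (by omega)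

end Line

/-! ### The distance function of a sheet -/

/-- Distances on a sheet whose entry line has direction `u` and distances `f`. -/
noncomputable def sheetDist (u : Dir) (f : ℤ → ℤ) (z : ℤ × ℤ) : ℤ :=
  (sInf (Set.range fun k : ℤ =>
    (f k + norm (z.1 - k * u.vec.1) (z.2 - k * u.vec.2)).toNat) : ℕ)

theorem sheetDist_nonneg (u : Dir) (f : ℤ → ℤ) (z : ℤ × ℤ) : 0 ≤ sheetDist u f z := by
  unfold sheetDist; positivity

theorem isDist_sheetDist (u : Dir) {f : ℤ → ℤ} (hf : ∀ k, 0 ≤ f k) :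
    IsDist u f (sheetDist u f) := by
  refine ⟨fun z => ?_, fun z k => ?_⟩
  · obtain ⟨k, hk⟩ := Nat.sInf_mem (Set.range_nonempty fun k : ℤ =>
      (f k + norm (z.1 - k * u.vec.1) (z.2 - k * u.vec.2)).toNat)
    refine ⟨k, ?_⟩
    have h1 := hf k
    have h2 := norm_nonneg (z.1 - k * u.vec.1) (z.2 - k * u.vec.2)
    dsimp only at hk
    rw [sheetDist, ← hk]
    omega
  · have h1 := hf k
    have h2 := norm_nonneg (z.1 - k * u.vec.1) (z.2 - k * u.vec.2)
    have h3 : sInf _ ≤ _ := Nat.sInf_le (Set.mem_range_self (f := fun k : ℤ =>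
      (f k + norm (z.1 - k * u.vec.1) (z.2 - k * u.vec.2)).toNat) k)
    unfold sheetDist
    omega

/-- The gluing directions are geodesics of unit speed, so a Lipschitz `f` is not shortened by
detours within the sheet. -/
theorem norm_smul_vec (u : Dir) (k : ℤ) : norm (k * u.vec.1) (k * u.vec.2) = max k (-k) := by
  cases u <;> simp only [Dir.vec, norm] <;> omega

theorem IsDist.apply_line {u : Dir} {f : ℤ → ℤ} {ℓ : ℤ × ℤ → ℤ} (h : IsDist u f ℓ) (hf : Lip f)
    (k : ℤ) : ℓ (k • u.vec) = f k := by
  have h1 := h.le (k • u.vec) k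
  obtain ⟨l, hl⟩ := h.exists_eq (k • u.vec)
  simp only [Prod.smul_fst, Prod.smul_snd, smul_eq_mul, ← sub_mul, norm_smul_vec] at h1 hl
  have h2 := hf k l
  omega

theorem norm_eq_one {x y : ℤ} (h : norm x y = 1) :
    (x = 1 ∧ y = 0) ∨ (x = -1 ∧ y = 0) ∨ (x = 0 ∧ y = 1) ∨ (x = 0 ∧ y = -1) ∨
    (x = 1 ∧ y = 1) ∨ (x = -1 ∧ y = -1) ∨ (x = 2 ∧ y = 2) ∨ (x = -2 ∧ y = -2) := by
  have h1 : x - y ≤ 1 ∧ y - x ≤ 1 := by unfold norm at h; omega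
  have h2 : x ≤ 2 ∧ -2 ≤ x := by unfold norm at h; omega
  obtain ⟨h2, h3⟩ := h2
  obtain ⟨d, rfl⟩ : ∃ d, y = x + d := ⟨y - x, by omega⟩
  have h4 : d ≤ 1 := by omega
  have h5 : -1 ≤ d := by omega
  interval_cases x <;> interval_cases d <;> revert h <;> decide

/-- A step from the entry line towards `1` within the sheet stays on the line. -/
theorem IsDist.step_on_line {u : Dir} {f : ℤ → ℤ} {ℓ : ℤ × ℤ → ℤ} (h : IsDist u f ℓ)
    (hf : Lip f) {k : ℤ} {w : ℤ × ℤ} (hw : norm w.1 w.2 = 1)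
    (hlt : ℓ (k • u.vec + w) < f k) : w = (1 : ℤ) • u.vec ∨ w = (-1 : ℤ) • u.vec := by
  obtain ⟨l, hl⟩ := h.exists_eq (k • u.vec + w)
  have h2 := hf k l
  generalize ℓ (k • u.vec + w) = c at hl hlt
  obtain ⟨x, y⟩ := w
  have h3 := norm_eq_one hw
  -- By the Lipschitz property, a foot `l` yields less than `f k` only if its norm is below `|k -
  -- l|`; the eight unit vectors are then tested.
  have h4 : norm ((k • u.vec + (x, y)).1 - l * u.vec.1) ((k • u.vec + (x, y)).2 - l * u.vec.2) <
    max (k - l) (l - k) := by omega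
  clear hl hlt h2
  cases u <;> simp only [Dir.vec, Prod.fst_add, Prod.snd_add, Prod.smul_mk, smul_eq_mul,
    mul_one, mul_zero, Prod.mk.injEq] at h4 ⊢ <;>
  rcases h3 with ⟨rfl, rfl⟩ | ⟨rfl, rfl⟩ | ⟨rfl, rfl⟩ | ⟨rfl, rfl⟩ | ⟨rfl, rfl⟩ | ⟨rfl, rfl⟩ |
    ⟨rfl, rfl⟩ | ⟨rfl, rfl⟩ <;> first | (exfalso; unfold norm at h4; omega) | simp

/-! ### Itineraries and crossing between sheets -/

/-- The letters `s`, `t`, `s⁻¹` and `t⁻¹`. -/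
inductive Letter
  | s | t | sInv | tInv
  deriving DecidableEq

namespace Letter

/-- The inverse letter. -/
def inv : Letter → Letter
  | s => sInv
  | t => tInv
  | sInv => s
  | tInv => t

@[simp] theorem inv_inv (L : Letter) : L.inv.inv = L := by cases L <;> rfl

/-- The direction of the lines of a sheet along which the letter leaves the sheet. -/
def dir : Letter → Dir
  | s => .a
  | t => .b
  | sInv => .d
  | tInv => .d

/-- The direction vector of the exit lines. -/
def vec (L : Letter) : ℤ × ℤ := L.dir.vec

/-- The coordinate of a point on its exit line. -/
def coord : Letter → ℤ × ℤ → ℤ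
  | s, z => z.1
  | t, z => z.2
  -- Floor division: a `d`-line has its origin at height `0` or `1`.
  | sInv, z => z.2 / 2
  | tInv, z => z.2 / 2

/-- The origin of the exit line through a point. -/
def rep (L : Letter) (z : ℤ × ℤ) : ℤ × ℤ := z - L.coord z • L.vec

theorem coord_add_smul (L : Letter) (z : ℤ × ℤ) (k : ℤ) :
    L.coord (z + k • L.vec) = L.coord z + k := by
  cases L <;> simp [coord, vec, dir, Dir.vec] <;> omega

theorem coord_smul (L : Letter) (k : ℤ) : L.coord (k • L.vec) = k := by
  cases L <;> simp [coord, vec, dir, Dir.vec]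

theorem rep_add_smul (L : Letter) (z : ℤ × ℤ) (k : ℤ) : L.rep (z + k • L.vec) = L.rep z := by
  rw [rep, rep, coord_add_smul, add_smul]; abel

theorem rep_smul (L : Letter) (k : ℤ) : L.rep (k • L.vec) = 0 := by
  rw [rep, coord_smul, sub_self]

theorem rep_add_coord (L : Letter) (z : ℤ × ℤ) : L.rep z + L.coord z • L.vec = z := by
  rw [rep, sub_add_cancel]

theorem coord_rep (L : Letter) (z : ℤ × ℤ) : L.coord (L.rep z) = 0 := by
  have := L.coord_add_smul (L.rep z) (L.coord z)
  rw [rep_add_coord] at this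
  omega

theorem rep_eq_self (L : Letter) {r : ℤ × ℤ} (h : L.coord r = 0) : L.rep r = r := by
  rw [rep, h, zero_smul, sub_zero]

end Letter

/-- The exits through which a path from the sheet of `1` reaches another sheet, the last one
first: letters together with the origins of the exit lines. -/
abbrev Itinerary : Type := List (Letter × (ℤ × ℤ))

/-- The path does not go back through the line by which it entered the sheet. -/
def Forward (L : Letter) (r : ℤ × ℤ) : Itinerary → Prop
  | [] => True
  | (L', _) :: _ => ¬ (L = L'.inv ∧ r = 0)

/-- Itineraries without backtracking. -/
def Reduced : Itinerary → Prop
  | [] => True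
  | (L, r) :: σ => L.coord r = 0 ∧ Forward L r σ ∧ Reduced σ

/-- The direction of the entry line. -/
def entryDir : Itinerary → Dir
  -- The sheet of `1` has no entry line. The `d`-line through `1` with distances `|k|` stands in for
  -- it and yields the word norm itself.
  | [] => .d
  | (L, _) :: _ => L.inv.dir

/-- The distances of the points on the entry line from `1`. -/
noncomputable def entryDist : Itinerary → ℤ → ℤ
  | [], k => max k (-k)
  | (L, r) :: σ, k => 1 + sheetDist (entryDir σ) (entryDist σ) (r + k • L.vec)

/-- The distances of the points of the sheet from `1`. -/
noncomputable def level (w : Itinerary × (ℤ × ℤ)) : ℤ :=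
  sheetDist (entryDir w.1) (entryDist w.1) w.2

theorem entryDist_nonneg (σ : Itinerary) (k : ℤ) : 0 ≤ entryDist σ k := by
  cases σ with
  | nil => simp only [entryDist]; omega
  | cons e σ =>
    simp only [entryDist]
    have := sheetDist_nonneg (entryDir σ) (entryDist σ) (e.2 + k • e.1.vec)
    omega

theorem isDist_level (σ : Itinerary) :
    IsDist (entryDir σ) (entryDist σ) fun z => level (σ, z) :=
  isDist_sheetDist _ (entryDist_nonneg σ)

theorem dyadicConvex_entryDist (σ : Itinerary) : DyadicConvex (entryDist σ) := by
  induction σ with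
  | nil =>
    refine ⟨fun x y => ?_, fun n x y hxy => ?_⟩
    · simp only [entryDist]; omega
    · have : (0 : ℤ) < 2 ^ n := by positivity
      simp only [entryDist]; omega
  | cons e σ ih =>
    have h := (isDist_level σ).dyadicConvex ih e.1.dir e.2
    refine ⟨fun x y => ?_, fun n x y hxy => ?_⟩
    · have := h.lip x y
      simp only [entryDist]
      simp only [level] at this
      unfold Letter.vec
      omega
    · have := h.exchange n x y hxy
      simp only [entryDist]
      simp only [level] at this
      unfold Letter.vec
      omega

/-- Multiplication by a letter on the right. -/
def cross (L : Letter) : Itinerary × (ℤ × ℤ) → Itinerary × (ℤ × ℤ)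
  | ([], z) => ([(L, L.rep z)], L.coord z • L.inv.vec)
  | ((L', r) :: σ, z) =>
    if L = L'.inv ∧ L.rep z = 0 then (σ, r + L.coord z • L'.vec)
    else ((L, L.rep z) :: (L', r) :: σ, L.coord z • L.inv.vec)

theorem cross_forward {L : Letter} {σ : Itinerary} {z : ℤ × ℤ} (h : Forward L (L.rep z) σ) :
    cross L (σ, z) = ((L, L.rep z) :: σ, L.coord z • L.inv.vec) := by
  match σ, h with
  | [], _ => rfl
  | (L', r) :: σ, h => exact if_neg h

theorem cross_back {L : Letter} {σ : Itinerary} (r : ℤ × ℤ) (k : ℤ) :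
    cross L ((L.inv, r) :: σ, k • L.vec) = (σ, r + k • L.inv.vec) := by
  change (if L = L.inv.inv ∧ L.rep (k • L.vec) = 0 then (σ, r + L.coord (k • L.vec) • L.inv.vec)
    else ((L, L.rep (k • L.vec)) :: (L.inv, r) :: σ, L.coord (k • L.vec) • L.inv.vec)) = _
  rw [Letter.rep_smul, Letter.coord_smul, if_pos ⟨L.inv_inv.symm, rfl⟩]

/-- Multiplication by a letter leads to a new sheet or back to the previous one. -/
theorem cross_cases (L : Letter) (σ : Itinerary) (z : ℤ × ℤ) :
    Forward L (L.rep z) σ ∨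
      ∃ (τ : Itinerary) (r : ℤ × ℤ) (k : ℤ), σ = (L.inv, r) :: τ ∧ z = k • L.vec := by
  match σ with
  | [] => exact Or.inl trivial
  | (L', r) :: τ =>
    by_cases h : L = L'.inv ∧ L.rep z = 0
    · refine Or.inr ⟨τ, r, L.coord z, ?_, ?_⟩
      · rw [h.1, Letter.inv_inv]
      · conv_lhs => rw [← L.rep_add_coord z, h.2, zero_add]
    · exact Or.inl h

theorem reduced_cross (L : Letter) {w : Itinerary × (ℤ × ℤ)} (h : Reduced w.1) :
    Reduced (cross L w).1 := by
  obtain ⟨σ, z⟩ := w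
  rcases cross_cases L σ z with hf | ⟨τ, r, k, rfl, rfl⟩
  · rw [cross_forward hf]
    exact ⟨L.coord_rep z, hf, h⟩
  · rw [cross_back]
    exact h.2.2

theorem cross_inv_cross (L : Letter) {w : Itinerary × (ℤ × ℤ)} (h : Reduced w.1) :
    cross L.inv (cross L w) = w := by
  obtain ⟨σ, z⟩ := w
  rcases cross_cases L σ z with hf | ⟨τ, r, k, rfl, rfl⟩
  · rw [cross_forward hf]
    have := cross_back (L := L.inv) (σ := σ) (L.rep z) (L.coord z)
    rw [Letter.inv_inv] at this
    rw [this, Letter.rep_add_coord]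
  · rw [cross_back]
    obtain ⟨h1, h2, h3⟩ := h
    have e1 : L.inv.rep (r + k • L.inv.vec) = r := by
      rw [Letter.rep_add_smul, Letter.rep_eq_self _ h1]
    rw [cross_forward (by rwa [e1]), e1, Letter.coord_add_smul, h1, zero_add, Letter.inv_inv]

/-- This is the relation of the HNN extension: a step along the exit line before crossing equals a
step along the line on the other side after it. -/
theorem cross_add_vec (L : Letter) (σ : Itinerary) (z : ℤ × ℤ) :
    cross L (σ, z + L.vec) = ((cross L (σ, z)).1, (cross L (σ, z)).2 + L.inv.vec) := by
  rcases cross_cases L σ z with hf | ⟨τ, r, k, rfl, rfl⟩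
  · have e1 := L.rep_add_smul z 1
    have e2 := L.coord_add_smul z 1
    rw [one_smul] at e1 e2
    rw [cross_forward hf, cross_forward (by rwa [e1]), e1, e2, add_smul, one_smul]
  · have : k • L.vec + L.vec = (k + 1) • L.vec := by rw [add_smul, one_smul]
    rw [this, cross_back, cross_back, add_smul, one_smul, add_assoc]

theorem level_line (σ : Itinerary) (k : ℤ) :
    level (σ, k • (entryDir σ).vec) = entryDist σ k :=
  (isDist_level σ).apply_line (dyadicConvex_entryDist σ).lip k

theorem level_cons_line (L : Letter) (r : ℤ × ℤ) (σ : Itinerary) (k : ℤ) :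
    level ((L, r) :: σ, k • L.inv.vec) = 1 + level (σ, r + k • L.vec) :=
  level_line ((L, r) :: σ) k

theorem level_cross_forward {L : Letter} {σ : Itinerary} {z : ℤ × ℤ}
    (h : Forward L (L.rep z) σ) : level (cross L (σ, z)) = level (σ, z) + 1 := by
  rw [cross_forward h, level_cons_line, Letter.rep_add_coord, add_comm]

theorem level_cross_back {L : Letter} {σ : Itinerary} (r : ℤ × ℤ) (k : ℤ) :
    level (cross L ((L.inv, r) :: σ, k • L.vec)) = level ((L.inv, r) :: σ, k • L.vec) - 1 := by
  have := level_cons_line L.inv r σ k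
  rw [Letter.inv_inv] at this
  rw [this, cross_back]
  ring

/-! ### The action on states and the normal form -/

/-- The points of the sheets, which correspond to the elements of Wise's group. -/
abbrev State : Type := {w : Itinerary × (ℤ × ℤ) // Reduced w.1}

/-- Translation of every sheet. -/
def translate (v : ℤ × ℤ) : Equiv.Perm State where
  toFun w := ⟨(w.1.1, w.1.2 + v), w.2⟩
  invFun w := ⟨(w.1.1, w.1.2 - v), w.2⟩
  left_inv w := by simp
  right_inv w := by simp

theorem translate_mul (v w : ℤ × ℤ) : translate v * translate w = translate (w + v) := by
  ext1 x
  simp [translate, add_assoc]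

/-- Multiplication by a letter on the right, as a permutation. -/
def crossPerm (L : Letter) : Equiv.Perm State where
  toFun w := ⟨cross L w.1, reduced_cross L w.2⟩
  invFun w := ⟨cross L.inv w.1, reduced_cross L.inv w.2⟩
  left_inv w := Subtype.ext (cross_inv_cross L w.2)
  right_inv w := Subtype.ext (by simpa using cross_inv_cross L.inv w.2)

theorem crossPerm_mul_translate (L : Letter) :
    crossPerm L * translate L.vec = translate L.inv.vec * crossPerm L := by
  ext1 w
  exact Subtype.ext (cross_add_vec L w.1.1 w.1.2)

/-- The action of the generators on the states. -/
def genPerm : Gen → Equiv.Perm State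
  | .a => translate (1, 0)
  | .b => translate (0, 1)
  | .c => translate (1, 1)
  | .d => translate (2, 2)
  | .s => crossPerm .s
  | .t => crossPerm .t

theorem lift_genPerm_eq_one : ∀ r ∈ relators,
    FreeGroup.lift (fun x => MulOpposite.op (genPerm x)) r = 1 := by
  have key : ∀ L : Letter, crossPerm L * (translate L.vec * (crossPerm L)⁻¹) =
      translate L.inv.vec := by
    intro L
    rw [← mul_assoc, crossPerm_mul_translate, mul_inv_cancel_right]
  rintro r (rfl | rfl | rfl | rfl | rfl) <;>
  simp only [map_mul, map_inv, map_pow, FreeGroup.lift_apply_of, genPerm] <;>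
  rw [mul_inv_eq_one] <;> apply MulOpposite.unop_injective <;>
  simp only [MulOpposite.unop_mul, MulOpposite.unop_inv, MulOpposite.unop_op,
    pow_two, translate_mul]
  · rfl
  · rfl
  · rfl
  · exact key .s
  · exact key .t

/-- The right action of Wise's group on the states. -/
def action : WiseGroup →* (Equiv.Perm State)ᵐᵒᵖ :=
  PresentedGroup.toGroup lift_genPerm_eq_one

/-- The state of `1`. -/
def baseState : State := ⟨([], 0), trivial⟩

/-- The state of a group element. -/
def toState (g : WiseGroup) : State := (action g).unop baseState

theorem toState_mul (g h : WiseGroup) : toState (g * h) = (action h).unop (toState g) := by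
  simp [toState]

theorem toState_one : toState 1 = baseState := by
  simp [toState]

theorem action_of (x : Gen) : action (.of x) = MulOpposite.op (genPerm x) :=
  PresentedGroup.toGroup.of _

/-- The generators as elements of the group. -/
abbrev gen (x : Gen) : WiseGroup := PresentedGroup.of x

theorem gen_c : gen .c = gen .a * gen .b :=
  PresentedGroup.mk_eq_mk_of_mul_inv_mem (by simp [relators])

theorem gen_c' : gen .c = gen .b * gen .a :=
  PresentedGroup.mk_eq_mk_of_mul_inv_mem (by simp [relators])

theorem gen_d : gen .d = gen .c ^ 2 :=
  PresentedGroup.mk_eq_mk_of_mul_inv_mem (by simp [relators])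

theorem gen_s : (gen .s)⁻¹ * gen .a * gen .s = gen .d :=
  PresentedGroup.mk_eq_mk_of_mul_inv_mem (by simp [relators])

theorem gen_t : (gen .t)⁻¹ * gen .b * gen .t = gen .d :=
  PresentedGroup.mk_eq_mk_of_mul_inv_mem (by simp [relators])

theorem commute_ab : Commute (gen .a) (gen .b) :=
  gen_c.symm.trans gen_c'

/-- The element of the abelian subgroup with given coordinates. -/
def flat (z : ℤ × ℤ) : WiseGroup := gen .a ^ z.1 * gen .b ^ z.2

theorem flat_zero : flat 0 = 1 := by simp [flat]

theorem flat_add (z w : ℤ × ℤ) : flat (z + w) = flat z * flat w := by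
  simp only [flat, Prod.fst_add, Prod.snd_add, zpow_add]
  have := (commute_ab.zpow_zpow w.1 z.2).eq
  simp only [mul_assoc]
  rw [← mul_assoc (gen .a ^ w.1) (gen .b ^ z.2), this]
  simp only [mul_assoc]

theorem flat_neg (z : ℤ × ℤ) : flat (-z) = (flat z)⁻¹ := by
  rw [eq_inv_iff_mul_eq_one, ← flat_add, neg_add_cancel, flat_zero]

theorem flat_a : flat (1, 0) = gen .a := by simp [flat]
theorem flat_b : flat (0, 1) = gen .b := by simp [flat]
theorem flat_c : flat (1, 1) = gen .c := by simp [flat, gen_c]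
theorem flat_d : flat (2, 2) = gen .d := by
  rw [gen_d, pow_two, ← flat_c, ← flat_add]; rfl

/-- The group element of a letter. -/
def Letter.elt : Letter → WiseGroup
  | s => gen .s
  | t => gen .t
  | sInv => (gen .s)⁻¹
  | tInv => (gen .t)⁻¹

theorem Letter.elt_inv (L : Letter) : L.inv.elt = L.elt⁻¹ := by
  cases L <;> simp [inv, elt]

theorem flat_vec_mul_elt (L : Letter) : flat L.vec * L.elt = L.elt * flat L.inv.vec := by
  have hs := gen_s
  have ht := gen_t
  cases L <;> simp only [Letter.vec, Letter.dir, Letter.inv, Dir.vec, Letter.elt, flat_a, flat_b,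
    flat_d]
  · rw [← hs]; group
  · rw [← ht]; group
  · rw [← hs]; group
  · rw [← ht]; group

theorem flat_smul (k : ℤ) (z : ℤ × ℤ) : flat (k • z) = flat z ^ k := by
  induction k using Int.induction_on with
  | zero => simp [flat_zero]
  | succ n ih => rw [add_smul, one_smul, flat_add, ih, zpow_add_one]
  | pred n ih => rw [sub_smul, one_smul, sub_eq_add_neg, flat_add, flat_neg, ih, zpow_sub_one]

theorem flat_smul_vec_mul_elt (L : Letter) (k : ℤ) :
    flat (k • L.vec) * L.elt = L.elt * flat (k • L.inv.vec) := by
  rw [flat_smul, flat_smul]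
  have : SemiconjBy L.elt (flat L.inv.vec) (flat L.vec) := (flat_vec_mul_elt L).symm
  exact (this.zpow_right k).symm

/-- The group element which leads to a sheet. -/
def itineraryElt : Itinerary → WiseGroup
  | [] => 1
  | (L, r) :: σ => itineraryElt σ * flat r * L.elt

/-- The group element of a point of a sheet. -/
def stateElt (w : Itinerary × (ℤ × ℤ)) : WiseGroup := itineraryElt w.1 * flat w.2

theorem stateElt_add (σ : Itinerary) (z v : ℤ × ℤ) :
    stateElt (σ, z + v) = stateElt (σ, z) * flat v := by
  simp only [stateElt, flat_add, mul_assoc]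

theorem stateElt_cross (L : Letter) (w : Itinerary × (ℤ × ℤ)) :
    stateElt (cross L w) = stateElt w * L.elt := by
  obtain ⟨σ, z⟩ := w
  rcases cross_cases L σ z with hf | ⟨τ, r, k, rfl, rfl⟩
  · rw [cross_forward hf]
    conv_rhs => rw [← L.rep_add_coord z]
    simp only [stateElt, itineraryElt, flat_add, mul_assoc, flat_smul_vec_mul_elt]
  · rw [cross_back]
    simp only [stateElt, itineraryElt, flat_add, mul_assoc, flat_smul_vec_mul_elt, L.elt_inv,
      inv_mul_cancel_left]

theorem stateElt_genPerm (x : Gen) (w : State) : stateElt (genPerm x w) = stateElt w * gen x := by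
  cases x
  · rw [← flat_a]; exact stateElt_add _ _ _
  · rw [← flat_b]; exact stateElt_add _ _ _
  · rw [← flat_c]; exact stateElt_add _ _ _
  · rw [← flat_d]; exact stateElt_add _ _ _
  · exact stateElt_cross .s w
  · exact stateElt_cross .t w

theorem stateElt_action (g : WiseGroup) (w : State) :
    stateElt ((action g).unop w) = stateElt w * g := by
  have key : g ∈ ({
      carrier := {g | ∀ w : State, stateElt ((action g).unop w) = stateElt w * g}
      one_mem' := fun w => by simp
      mul_mem' := fun {g h} hg hh w => by
        rw [map_mul, MulOpposite.unop_mul, Equiv.Perm.mul_apply, hh, hg, mul_assoc]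
      inv_mem' := fun {g} hg w => by
        have := hg ((action g⁻¹).unop w)
        rw [← Equiv.Perm.mul_apply, ← MulOpposite.unop_mul, ← map_mul, inv_mul_cancel, map_one,
          MulOpposite.unop_one, Equiv.Perm.one_apply] at this
        rw [this, mul_inv_cancel_right] } : Subgroup WiseGroup) := by
    refine PresentedGroup.generated_by _ _ (fun x w => ?_) g
    rw [action_of, MulOpposite.unop_op]
    exact stateElt_genPerm x w
  exact key w

theorem stateElt_toState (g : WiseGroup) : stateElt (toState g) = g := by
  rw [toState, stateElt_action]
  simp [stateElt, itineraryElt, baseState, flat_zero]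

theorem action_flat (z : ℤ × ℤ) : (action (flat z)).unop = translate z := by
  have ha : action (gen .a) = .op (translate (1, 0)) := action_of _
  have hb : action (gen .b) = .op (translate (0, 1)) := action_of _
  have hz : ∀ (k : ℤ) (v : ℤ × ℤ), translate v ^ k = translate (k • v) := by
    intro k v
    have h0 : translate 0 = 1 := by ext1 w; simp [translate]
    have hinv : (translate v)⁻¹ = translate (-v) := by
      rw [inv_eq_iff_mul_eq_one, translate_mul, neg_add_cancel, h0]
    induction k using Int.induction_on with
    | zero => simp [h0]
    | succ n ih => rw [zpow_add_one, ih, translate_mul, add_smul, one_smul, add_comm]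
    | pred n ih => rw [zpow_sub_one, ih, hinv, translate_mul, sub_smul, one_smul, add_comm,
        sub_eq_add_neg]
  rw [flat, map_mul, map_zpow, map_zpow, ha, hb, ← MulOpposite.op_zpow, ← MulOpposite.op_zpow,
    ← MulOpposite.op_mul, MulOpposite.unop_op, hz, hz, translate_mul]
  simp

theorem action_elt (L : Letter) : (action L.elt).unop = crossPerm L := by
  have hs : action (gen .s) = .op (crossPerm .s) := action_of _
  have ht : action (gen .t) = .op (crossPerm .t) := action_of _
  cases L <;> simp only [Letter.elt, map_inv, hs, ht, MulOpposite.unop_op, MulOpposite.unop_inv]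
  · rfl
  · rfl

/-- Van der Waerden's argument: applied to the base state, a reduced itinerary rebuilds itself
letter by letter, since reducedness excludes the backward branch of `cross`. Uniqueness of normal
forms follows. -/
theorem toState_itineraryElt {σ : Itinerary} (h : Reduced σ) :
    toState (itineraryElt σ) = ⟨(σ, 0), h⟩ := by
  induction σ with
  | nil => exact toState_one
  | cons e σ ih =>
    obtain ⟨L, r⟩ := e
    obtain ⟨h1, h2, h3⟩ := h
    rw [itineraryElt, toState_mul, toState_mul, ih h3, action_flat, action_elt]
    apply Subtype.ext
    change cross L (σ, 0 + r) = ((L, r) :: σ, 0)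
    rw [zero_add, cross_forward (by rwa [L.rep_eq_self h1]), L.rep_eq_self h1, h1, zero_smul]

theorem toState_stateElt {σ : Itinerary} (h : Reduced σ) (z : ℤ × ℤ) :
    toState (stateElt (σ, z)) = ⟨(σ, z), h⟩ := by
  rw [stateElt, toState_mul, toState_itineraryElt h, action_flat]
  apply Subtype.ext
  change (σ, 0 + z) = _
  rw [zero_add]

theorem exists_stateElt (g : WiseGroup) : ∃ σ z, Reduced σ ∧ stateElt (σ, z) = g :=
  ⟨_, _, (toState g).2, stateElt_toState g⟩

theorem stateElt_injective {w w' : Itinerary × (ℤ × ℤ)} (h : Reduced w.1) (h' : Reduced w'.1)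
    (heq : stateElt w = stateElt w') : w = w' := by
  have := congrArg toState heq
  rw [toState_stateElt h, toState_stateElt h'] at this
  exact congrArg Subtype.val this

/-! ### The recursive level is the word length -/

/-- The Cayley graph of Wise's group. -/
abbrev cayley : SimpleGraph WiseGroup := SimpleGraph.mulCayley generators

/-- The distance of a group element from `1`, computed from its normal form. -/
noncomputable def lev (g : WiseGroup) : ℤ := level (toState g).1

theorem lev_stateElt {σ : Itinerary} (h : Reduced σ) (z : ℤ × ℤ) :
    lev (stateElt (σ, z)) = level (σ, z) := by
  rw [lev, toState_stateElt h]

theorem lev_nonneg (g : WiseGroup) : 0 ≤ lev g := sheetDist_nonneg _ _ _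

theorem lev_one : lev 1 = 0 := by
  have := level_line [] 0
  rw [zero_smul] at this
  rw [lev, toState_one]
  change level ([], 0) = 0
  simpa [entryDist] using this

theorem gen_mem_generators (x : Gen) : gen x ∈ generators := by
  cases x <;> simp [generators]

theorem adj_mul_gen {g : WiseGroup} {x : Gen} (h : g ≠ g * gen x) : cayley.Adj g (g * gen x) :=
  (SimpleGraph.mulCayley_adj' _ _ _).2 ⟨h, _, gen_mem_generators x, Or.inl rfl⟩

theorem adj_mul_gen_inv {g : WiseGroup} {x : Gen} (h : g ≠ g * (gen x)⁻¹) :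
    cayley.Adj g (g * (gen x)⁻¹) :=
  (SimpleGraph.mulCayley_adj' _ _ _).2
    ⟨h, _, gen_mem_generators x, Or.inr (inv_mul_cancel_right _ _).symm⟩

theorem flat_of_norm_eq_one {w : ℤ × ℤ} (hw : norm w.1 w.2 = 1) :
    ∃ x, flat w = gen x ∨ flat w = (gen x)⁻¹ := by
  obtain ⟨x, y⟩ := w
  rcases norm_eq_one hw with h | h | h | h | h | h | h | h <;> obtain ⟨h1, h2⟩ := h <;>
    dsimp only at h1 h2 <;> subst h1 h2
  · exact ⟨.a, Or.inl flat_a⟩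
  · exact ⟨.a, Or.inr (by rw [← flat_a, ← flat_neg]; rfl)⟩
  · exact ⟨.b, Or.inl flat_b⟩
  · exact ⟨.b, Or.inr (by rw [← flat_b, ← flat_neg]; rfl)⟩
  · exact ⟨.c, Or.inl flat_c⟩
  · exact ⟨.c, Or.inr (by rw [← flat_c, ← flat_neg]; rfl)⟩
  · exact ⟨.d, Or.inl flat_d⟩
  · exact ⟨.d, Or.inr (by rw [← flat_d, ← flat_neg]; rfl)⟩

theorem adj_flat {σ : Itinerary} (h : Reduced σ) (z : ℤ × ℤ) {w : ℤ × ℤ}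
    (hw : norm w.1 w.2 = 1) : cayley.Adj (stateElt (σ, z)) (stateElt (σ, z + w)) := by
  have hne : stateElt (σ, z) ≠ stateElt (σ, z + w) := by
    intro heq
    have := congrArg Prod.snd (stateElt_injective (w := (σ, z)) (w' := (σ, z + w)) h h heq)
    obtain rfl : w = 0 := by simpa using this
    simp [norm] at hw
  rw [stateElt_add] at hne ⊢
  obtain ⟨x, hx | hx⟩ := flat_of_norm_eq_one hw <;> rw [hx] at hne ⊢
  · exact adj_mul_gen hne
  · exact adj_mul_gen_inv hne

theorem level_cross_ne (L : Letter) (w : Itinerary × (ℤ × ℤ)) : level (cross L w) ≠ level w := by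
  obtain ⟨σ, z⟩ := w
  rcases cross_cases L σ z with hf | ⟨τ, r, k, rfl, rfl⟩
  · rw [level_cross_forward hf]; omega
  · rw [level_cross_back]; omega

theorem adj_cross (L : Letter) {w : Itinerary × (ℤ × ℤ)} (h : Reduced w.1) :
    cayley.Adj (stateElt w) (stateElt (cross L w)) := by
  have hne : stateElt w ≠ stateElt (cross L w) := by
    intro heq
    exact level_cross_ne L w
      (congrArg level (stateElt_injective h (reduced_cross L h) heq).symm)
  rw [stateElt_cross] at hne ⊢
  cases L
  · exact adj_mul_gen hne
  · exact adj_mul_gen hne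
  · exact adj_mul_gen_inv hne
  · exact adj_mul_gen_inv hne

/-- The neighbours of an element are in the same sheet or across an exit. -/
theorem adj_cases {σ : Itinerary} {z : ℤ × ℤ} {v : WiseGroup}
    (h : cayley.Adj (stateElt (σ, z)) v) :
    (∃ w, norm w.1 w.2 = 1 ∧ v = stateElt (σ, z + w)) ∨ ∃ L, v = stateElt (cross L (σ, z)) := by
  obtain ⟨-, x, hx, hv⟩ := (SimpleGraph.mulCayley_adj' _ _ _).1 h
  have flat_case : ∀ w, norm w.1 w.2 = 1 → x = flat w →
      (∃ w, norm w.1 w.2 = 1 ∧ v = stateElt (σ, z + w)) := by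
    rintro w hw rfl
    rcases hv with hv | hv
    · exact ⟨w, hw, by rw [stateElt_add, hv]⟩
    · refine ⟨-w, ?_, ?_⟩
      · have : norm (-w).1 (-w).2 = norm w.1 w.2 := by
          simp only [norm, Prod.fst_neg, Prod.snd_neg]; omega
        rw [this, hw]
      · rw [stateElt_add, flat_neg, hv, mul_inv_cancel_right]
  have letter_case : ∀ L : Letter, x = L.elt → ∃ L, v = stateElt (cross L (σ, z)) := by
    rintro L rfl
    rcases hv with hv | hv
    · exact ⟨L, by rw [stateElt_cross, hv]⟩
    · exact ⟨L.inv, by rw [stateElt_cross, hv, Letter.elt_inv, mul_inv_cancel_right]⟩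
  rcases hx with rfl | rfl | rfl | rfl | rfl | rfl
  · exact Or.inl (flat_case (1, 0) (by decide) flat_a.symm)
  · exact Or.inl (flat_case (0, 1) (by decide) flat_b.symm)
  · exact Or.inl (flat_case (1, 1) (by decide) flat_c.symm)
  · exact Or.inl (flat_case (2, 2) (by decide) flat_d.symm)
  · exact Or.inr (letter_case .s rfl)
  · exact Or.inr (letter_case .t rfl)

theorem norm_vec (u : Dir) : norm u.vec.1 u.vec.2 = 1 := by cases u <;> decide

theorem lev_le_of_adj {u v : WiseGroup} (h : cayley.Adj u v) : lev v ≤ lev u + 1 := by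
  obtain ⟨σ, z, hσ, rfl⟩ := exists_stateElt u
  rcases adj_cases h with ⟨w, hw, rfl⟩ | ⟨L, rfl⟩
  · rw [lev_stateElt hσ, lev_stateElt hσ]
    have := (isDist_level σ).le_add (z + w) z
    rwa [← Prod.fst_sub, ← Prod.snd_sub, add_sub_cancel_left, hw] at this
  · have := reduced_cross L (w := (σ, z)) hσ
    rw [lev_stateElt hσ, lev_stateElt this]
    rcases cross_cases L σ z with hf | ⟨τ, r, k, rfl, rfl⟩
    · exact (level_cross_forward hf).le
    · change level (cross L ((L.inv, r) :: τ, k • L.vec)) ≤ _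
      rw [level_cross_back]
      omega

theorem lev_le_of_walk {u v : WiseGroup} (p : cayley.Walk u v) : lev v ≤ lev u + p.length := by
  induction p with
  | nil => simp
  | cons h p ih =>
    have := lev_le_of_adj h
    rw [SimpleGraph.Walk.length_cons]
    push_cast
    omega

/-- Off the entry line one steps toward an optimal foot; on it one crosses back to the previous
sheet or, in the sheet of `1`, moves along the line toward `1`. With the bound of `lev_le_of_adj`
this identifies `lev` with the distance. -/
theorem exists_adj_lev_lt {g : WiseGroup} (hg : g ≠ 1) : ∃ h, cayley.Adj g h ∧ lev h < lev g := by
  obtain ⟨σ, z, hσ, rfl⟩ := exists_stateElt g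
  obtain ⟨k, hk⟩ := (isDist_level σ).exists_eq z
  rw [lev_stateElt hσ]
  by_cases hn : 0 < norm (z.1 - k * (entryDir σ).vec.1) (z.2 - k * (entryDir σ).vec.2)
  · obtain ⟨i, j, h1, h2⟩ := exists_norm_step hn
    have h3 := (isDist_level σ).le (z - (i, j)) k
    refine ⟨stateElt (σ, z - (i, j)), ?_, ?_⟩
    · have := adj_flat hσ (z - (i, j)) (w := (i, j)) h1
      rw [sub_add_cancel] at this
      exact this.symm
    · rw [lev_stateElt hσ]
      simp only [Prod.fst_sub, Prod.snd_sub, sub_right_comm _ i, sub_right_comm _ j] at h3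
      omega
  · obtain rfl : z = k • (entryDir σ).vec := by
      ext
      · rw [Prod.smul_fst, smul_eq_mul]; unfold norm at hn; omega
      · rw [Prod.smul_snd, smul_eq_mul]; unfold norm at hn; omega
    match σ with
    | [] =>
      have hk0 : k ≠ 0 := by
        rintro rfl
        exact hg (by simp [stateElt, itineraryElt, flat_zero])
      obtain ⟨l, hl, hkl⟩ : ∃ l : ℤ, (l = 1 ∨ l = -1) ∧ max (k + l) (-(k + l)) < max k (-k) := by
        rcases lt_or_gt_of_ne hk0 with h | h
        · exact ⟨1, by simp, by omega⟩
        · exact ⟨-1, by simp, by omega⟩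
      refine ⟨stateElt ([], k • (entryDir []).vec + l • (entryDir []).vec), adj_flat hσ _ ?_, ?_⟩
      · rcases hl with rfl | rfl <;> decide
      · rw [lev_stateElt hσ, ← add_smul, level_line, level_line]
        exact hkl
    | (L, r) :: τ =>
      have := level_cross_back (L := L.inv) (σ := τ) r k
      rw [Letter.inv_inv] at this
      refine ⟨_, adj_cross L.inv hσ, ?_⟩
      rw [lev, toState_stateElt (reduced_cross L.inv (w := ((L, r) :: τ, _)) hσ)]
      change level (cross L.inv ((L, r) :: τ, k • L.inv.vec)) < level ((L, r) :: τ, k • L.inv.vec)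
      omega

theorem exists_walk_length_le_lev (n : ℕ) : ∀ g : WiseGroup, lev g ≤ n →
    ∃ p : cayley.Walk 1 g, (p.length : ℤ) ≤ lev g := by
  induction n with
  | zero =>
    intro g hg
    by_cases h1 : g = 1
    · subst h1; exact ⟨.nil, by simpa using lev_nonneg 1⟩
    · obtain ⟨h, -, hlt⟩ := exists_adj_lev_lt h1
      have := lev_nonneg h
      omega
  | succ n ih =>
    intro g hg
    by_cases h1 : g = 1
    · subst h1; exact ⟨.nil, by simpa using lev_nonneg 1⟩
    · obtain ⟨h, hadj, hlt⟩ := exists_adj_lev_lt h1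
      obtain ⟨p, hp⟩ := ih h (by push_cast at hg; omega)
      refine ⟨p.concat hadj.symm, ?_⟩
      rw [SimpleGraph.Walk.length_concat]
      push_cast
      omega

theorem exists_walk_length_le_lev' (g : WiseGroup) :
    ∃ p : cayley.Walk 1 g, (p.length : ℤ) ≤ lev g :=
  exists_walk_length_le_lev (lev g).toNat g (by have := lev_nonneg g; omega)

theorem cayley_connected (g h : WiseGroup) : cayley.Reachable g h := by
  obtain ⟨p, -⟩ := exists_walk_length_le_lev' g
  obtain ⟨q, -⟩ := exists_walk_length_le_lev' h
  exact ⟨p.reverse.append q⟩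

theorem wordLength_eq_lev (g : WiseGroup) : (wordLength generators g : ℤ) = lev g := by
  apply le_antisymm
  · obtain ⟨p, hp⟩ := exists_walk_length_le_lev' g
    have : wordLength generators g ≤ p.length := SimpleGraph.dist_le p
    omega
  · obtain ⟨p, hp⟩ := (cayley_connected 1 g).exists_walk_length_eq_dist
    have := lev_le_of_walk p
    rw [lev_one, hp] at this
    simpa [wordLength] using this

/-! ### Almost convexity -/

theorem linked_entry_line {σ : Itinerary} (hσ : Reduced σ) {N p q : ℤ} (hp : entryDist σ p ≤ N)
    (hq : entryDist σ q ≤ N) :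
    Linked cayley lev N (max (p - q) (q - p) + 2) (stateElt (σ, p • (entryDir σ).vec))
      (stateElt (σ, q • (entryDir σ).vec)) := by
  have hlev : ∀ k : ℤ, lev (stateElt (σ, k • (entryDir σ).vec)) = entryDist σ k := fun k => by
    rw [lev_stateElt hσ, level_line]
  match σ with
  | [] =>
    refine linked_of_abs (φ := fun k => stateElt ([], k • (entryDir []).vec)) hlev (fun k => ?_)
      hp hq
    have := adj_flat hσ (k • (entryDir []).vec) (norm_vec (entryDir []))
    rwa [add_smul, one_smul]
  | (L, r) :: τ =>
    have hf := dyadicConvex_entryDist ((L, r) :: τ)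
    refine linked_of_parallel (f := entryDist ((L, r) :: τ))
      (φ := fun k => stateElt ((L, r) :: τ, k • L.inv.vec))
      (π := fun k => stateElt (τ, r + k • L.vec)) hf.lip
      (by simpa using hf.exchange 0) hlev (fun k => ?_) (fun k => ?_) (fun k => ?_) hp hq
    · rw [lev_stateElt hσ.2.2, ← level_line]
      have := level_cons_line L r τ k
      change _ = level ((L, r) :: τ, k • L.inv.vec) - 1
      omega
    · have h1 := adj_cross L.inv (w := ((L, r) :: τ, k • L.inv.vec)) hσ
      have h2 := cross_back (L := L.inv) (σ := τ) r k
      rw [Letter.inv_inv] at h2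
      rwa [h2] at h1
    · have := adj_flat hσ.2.2 (r + k • L.vec) (norm_vec L.dir)
      rwa [add_smul, one_smul, ← add_assoc]

theorem linked_sheet {σ : Itinerary} (hσ : Reduced σ) {N : ℤ} {z z' : ℤ × ℤ}
    (hn : norm (z.1 - z'.1) (z.2 - z'.2) ≤ 2) (hz : level (σ, z) ≤ N) (hz' : level (σ, z') ≤ N) :
    Linked cayley lev N 200 (stateElt (σ, z)) (stateElt (σ, z')) :=
  (isDist_level σ).linked (dyadicConvex_entryDist σ) (φ := fun z => stateElt (σ, z))
    (fun z _ hw => adj_flat hσ z hw) (fun z => lev_stateElt hσ z) hn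
    (fun _ _ hp hq => linked_entry_line hσ hp hq) hz hz'

/-- A letter edge that goes down leads back across the entry line, so the middle vertex lies on that
line, and by `IsDist.step_on_line` so does the other endpoint. Crossing back there too gives a path
of length two through level `N - 1`. -/
theorem linked_of_cross_of_flat {σ : Itinerary} (hσ : Reduced σ) {z w : ℤ × ℤ} {L : Letter} {N : ℤ}
    (hw : norm w.1 w.2 = 1) (hz : N < level (σ, z)) (hu : level (cross L (σ, z)) = N)
    (hv : level (σ, z + w) = N) :
    Linked cayley lev N 200 (stateElt (cross L (σ, z))) (stateElt (σ, z + w)) := by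
  rcases cross_cases L σ z with hf | ⟨τ, r, k, rfl, rfl⟩
  · rw [level_cross_forward hf] at hu
    omega
  have hl := level_line ((L.inv, r) :: τ) k
  have hvec : (entryDir ((L.inv, r) :: τ)).vec = L.vec := by
    change L.inv.inv.dir.vec = L.dir.vec
    rw [Letter.inv_inv]
  rw [hvec] at hl
  obtain ⟨l, hl1, rfl⟩ : ∃ l : ℤ, (l = 1 ∨ l = -1) ∧ w = l • L.vec := by
    have := (isDist_level ((L.inv, r) :: τ)).step_on_line (k := k)
      (dyadicConvex_entryDist _).lip hw (by rw [hvec]; omega)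
    rw [hvec] at this
    rcases this with h | h
    · exact ⟨1, by simp, h⟩
    · exact ⟨-1, by simp, h⟩
  have e1 : k • L.vec + l • L.vec = (k + l) • L.vec := (add_smul k l L.vec).symm
  rw [e1] at hv ⊢
  have h1 := level_cross_back (L := L) (σ := τ) r (k + l)
  have hadj := adj_cross L (w := ((L.inv, r) :: τ, (k + l) • L.vec)) hσ
  have hτ : Reduced τ := hσ.2.2
  have hadj2 : cayley.Adj (stateElt (cross L ((L.inv, r) :: τ, k • L.vec)))
      (stateElt (cross L ((L.inv, r) :: τ, (k + l) • L.vec))) := by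
    rw [cross_back, cross_back, add_smul, ← add_assoc]
    refine adj_flat hτ _ ?_
    have := norm_smul_vec L.inv.dir l
    rcases hl1 with rfl | rfl
    · exact this
    · exact this
  have l1 : lev (stateElt (cross L ((L.inv, r) :: τ, k • L.vec))) = N := by
    rw [lev, toState_stateElt (reduced_cross L (w := ((L.inv, r) :: τ, k • L.vec)) hσ)]
    exact hu
  have l2 : lev (stateElt (cross L ((L.inv, r) :: τ, (k + l) • L.vec))) = N - 1 := by
    rw [lev, toState_stateElt (reduced_cross L (w := ((L.inv, r) :: τ, (k + l) • L.vec)) hσ)]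
    change level (cross L ((L.inv, r) :: τ, (k + l) • L.vec)) = N - 1
    omega
  have l3 : lev (stateElt ((L.inv, r) :: τ, (k + l) • L.vec)) = N := by
    rw [lev_stateElt hσ, hv]
  exact ((Linked.of_adj hadj2 (by omega) (by omega) (by omega)).trans
    (Linked.of_adj hadj.symm (by omega) (by omega) (by omega))).mono (by norm_num)

theorem linked_of_adj_adj {u w v : WiseGroup} {N : ℤ} (huw : cayley.Adj w u) (hwv : cayley.Adj w v)
    (hu : lev u = N) (hv : lev v = N) : Linked cayley lev N 200 u v := by
  by_cases hw : lev w < N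
  · exact ((Linked.of_adj huw.symm (by omega) (by omega) (by omega)).trans
      (Linked.of_adj hwv (by omega) (by omega) (by omega))).mono (by norm_num)
  obtain ⟨σ, z, hσ, rfl⟩ := exists_stateElt w
  rw [lev_stateElt hσ] at hw
  have hc : ∀ L, lev (stateElt (cross L (σ, z))) = level (cross L (σ, z)) := fun L => by
    rw [lev, toState_stateElt (reduced_cross L (w := (σ, z)) hσ)]
  have hne : ∀ L, lev (stateElt (cross L (σ, z))) = N → N < level (σ, z) := by
    intro L hL
    rw [hc] at hL
    have := level_cross_ne L (σ, z)
    omega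
  rcases adj_cases huw with ⟨i, hi, rfl⟩ | ⟨L, rfl⟩
  · rcases adj_cases hwv with ⟨j, hj, rfl⟩ | ⟨L, rfl⟩
    · rw [lev_stateElt hσ] at hu hv
      refine linked_sheet hσ ?_ hu.le hv.le
      simp only [Prod.fst_add, Prod.snd_add, add_sub_add_left_eq_sub]
      unfold norm at *; omega
    · rw [lev_stateElt hσ] at hu
      exact (linked_of_cross_of_flat hσ hi (hne L hv) (by rw [← hc, hv]) hu).symm
  · rcases adj_cases hwv with ⟨j, hj, rfl⟩ | ⟨L', rfl⟩
    · rw [lev_stateElt hσ] at hv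
      exact linked_of_cross_of_flat hσ hj (hne L hu) (by rw [← hc, hu]) hv
    · have h1 := hne L hu
      rw [hc] at hu hv
      rcases cross_cases L σ z with hf | ⟨τ, r, k, rfl, rfl⟩
      · rw [level_cross_forward hf] at hu; omega
      rcases cross_cases L' ((L.inv, r) :: τ) (k • L.vec) with hf | ⟨τ', r', k', h2, h3⟩
      · rw [level_cross_forward hf] at hv; omega
      -- Both letters lead back across the same entry line, so they agree and the endpoints
      -- coincide.
      have h4 : L = L' := by
        have := congrArg (fun e : Itinerary => e.head?.map fun x => x.1.inv) h2
        simpa using this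
      subst h4
      exact Linked.refl (by norm_num) (by rw [hc]; omega)

theorem linked_of_adj_lev_eq {u v : WiseGroup} {N : ℤ} (huv : cayley.Adj u v)
    (hu : lev u = N) (hv : lev v = N) : Linked cayley lev N 200 u v := by
  obtain ⟨σ, z, hσ, rfl⟩ := exists_stateElt u
  rw [lev_stateElt hσ] at hu
  rcases adj_cases huv with ⟨w, hw, rfl⟩ | ⟨L, rfl⟩
  · rw [lev_stateElt hσ] at hv
    refine linked_sheet hσ ?_ hu.le hv.le
    have : norm (z.1 - (z + w).1) (z.2 - (z + w).2) = norm w.1 w.2 := by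
      simp only [norm, Prod.fst_add, Prod.snd_add]; omega
    omega
  · rw [lev, toState_stateElt (reduced_cross L (w := (σ, z)) hσ)] at hv
    exact absurd (hv.trans hu.symm) (level_cross_ne L _)

theorem linked_of_dist_le_two {u v : WiseGroup} {N : ℤ} (huv : cayley.dist u v ≤ 2)
    (hu : lev u = N) (hv : lev v = N) : Linked cayley lev N 200 u v := by
  obtain ⟨p, hp⟩ := (cayley_connected u v).exists_walk_length_eq_dist
  rw [← hp] at huv
  match p, huv with
  | .nil, _ => exact Linked.refl (by norm_num) hu.le
  | .cons h .nil, _ => exact linked_of_adj_lev_eq h hu hv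
  | .cons h (.cons h' .nil), _ => exact linked_of_adj_adj h.symm h' hu hv
  | .cons _ (.cons _ (.cons _ _)), h =>
    simp only [SimpleGraph.Walk.length_cons] at h
    omega

theorem isAlmostConvex : IsAlmostConvex WiseGroup generators where
  finite := by unfold generators; exact Set.toFinite _
  generates := by
    rw [eq_top_iff, ← PresentedGroup.closure_range_of relators]
    apply Subgroup.closure_mono
    rintro _ ⟨x, rfl⟩
    exact gen_mem_generators x
  exists_bound := by
    refine ⟨200, by norm_num, fun N g h hg hh hgh => ?_⟩
    obtain ⟨p, p1, p2, p3⟩ := linked_of_dist_le_two (N := N) hgh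
      (by rw [← wordLength_eq_lev, hg]) (by rw [← wordLength_eq_lev, hh])
    refine ⟨p, by omega, fun v hv => ?_, fun e he => ?_⟩
    · have := p2 v hv
      rw [← wordLength_eq_lev] at this
      omega
    · have := p3 e he
      rw [← wordLength_eq_lev, ← wordLength_eq_lev] at this
      omega

/-! ### The surjective endomorphism with a kernel -/

/-- The images of the generators under the endomorphism which squares `a` and `b` and fixes `s`
and `t`. -/
def squareGen : Gen → WiseGroup
  | .a => flat (2, 0)
  | .b => flat (0, 2)
  | .c => flat (2, 2)
  | .d => flat (4, 4)
  | .s => gen .s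
  | .t => gen .t

theorem lift_squareGen_eq_one : ∀ r ∈ relators, FreeGroup.lift squareGen r = 1 := by
  have key : ∀ L : Letter, L.elt⁻¹ * flat ((2 : ℤ) • L.vec) * L.elt = flat ((2 : ℤ) • L.inv.vec) := by
    intro L
    rw [mul_assoc, flat_smul_vec_mul_elt, inv_mul_cancel_left]
  rintro r (rfl | rfl | rfl | rfl | rfl) <;>
  simp only [map_mul, map_inv, map_pow, FreeGroup.lift_apply_of, squareGen] <;>
  rw [mul_inv_eq_one]
  · rw [← flat_add]; rfl
  · rw [← flat_add]; rfl
  · rw [pow_two, ← flat_add]; rfl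
  · exact key .s
  · exact key .t

/-- The endomorphism which squares `a` and `b` and fixes `s` and `t`. -/
def squareHom : WiseGroup →* WiseGroup := PresentedGroup.toGroup lift_squareGen_eq_one

theorem squareHom_gen (x : Gen) : squareHom (gen x) = squareGen x := PresentedGroup.toGroup.of _

theorem squareHom_surjective : Function.Surjective squareHom := by
  rw [← MonoidHom.range_eq_top, eq_top_iff]
  rintro g -
  have hs : gen .s ∈ squareHom.range := ⟨gen .s, squareHom_gen .s⟩
  have ht : gen .t ∈ squareHom.range := ⟨gen .t, squareHom_gen .t⟩
  have hd : gen .d ∈ squareHom.range := ⟨gen .c, by rw [squareHom_gen, ← flat_d]; rfl⟩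
  have ha : gen .a ∈ squareHom.range := by
    have : gen .a = gen .s * gen .d * (gen .s)⁻¹ := by rw [← gen_s]; group
    rw [this]; exact mul_mem (mul_mem hs hd) (inv_mem hs)
  have hb : gen .b ∈ squareHom.range := by
    have : gen .b = gen .t * gen .d * (gen .t)⁻¹ := by rw [← gen_t]; group
    rw [this]; exact mul_mem (mul_mem ht hd) (inv_mem ht)
  refine PresentedGroup.generated_by relators _ (fun x => ?_) g
  change gen x ∈ _
  cases x
  · exact ha
  · exact hb
  · rw [gen_c]; exact mul_mem ha hb
  · exact hd
  · exact hs
  · exact ht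

/-- The image of `s c s⁻¹` is `s d s⁻¹ = a`, which commutes with `b²`, the image of `b`. But `s c
s⁻¹` and `b` do not commute: as `(1,1)` is off the `d`-line through the origin, both products are in
normal form, with different itineraries. -/
theorem squareHom_not_injective : ¬ Function.Injective squareHom := by
  intro hinj
  have hc : squareHom (gen .s * gen .c * (gen .s)⁻¹) = gen .a := by
    rw [map_mul, map_mul, map_inv, squareHom_gen, squareHom_gen]
    simp only [squareGen]
    rw [flat_d, ← gen_s]
    group
  have hcomm : gen .s * gen .c * (gen .s)⁻¹ * gen .b = gen .b * (gen .s * gen .c * (gen .s)⁻¹) := by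
    apply hinj
    rw [map_mul, map_mul squareHom (gen .b), hc, squareHom_gen]
    simp only [squareGen]
    rw [← flat_a, ← flat_add, ← flat_add, add_comm]
  have h1 : gen .s * gen .c * (gen .s)⁻¹ * gen .b =
      stateElt ([(.sInv, (1, 1)), (.s, (0, 0))], (0, 1)) := by
    have h0 : flat (0, 0) = 1 := flat_zero
    simp only [stateElt, itineraryElt, flat_b, flat_c, h0, Letter.elt, one_mul, mul_one]
  have h2 : gen .b * (gen .s * gen .c * (gen .s)⁻¹) =
      stateElt ([(.sInv, (1, 1)), (.s, (0, 1))], (0, 0)) := by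
    have h0 : flat (0, 0) = 1 := flat_zero
    simp only [stateElt, itineraryElt, flat_b, flat_c, h0, Letter.elt, one_mul, mul_one, mul_assoc]
  rw [h1, h2] at hcomm
  have := stateElt_injective (by simp [Reduced, Forward, Letter.coord])
    (by simp [Reduced, Forward, Letter.coord]) hcomm
  simp at this

end Wise

theorem mainTheorem2 :
    IsAlmostConvex WiseGroup Wise.generators ∧ ¬ IsHopfian WiseGroup :=
  ⟨Wise.isAlmostConvex,
    fun h => Wise.squareHom_not_injective (h _ Wise.squareHom_surjective)⟩
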